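/- **Setting.** Let $Y$ be a non-empty set, $c\ge 1$, and let $\ell:Y^2\to\mathbb R_{\ge 0}$ be a $c$-approximate pseudo-metric: $\ell(y,y)=0$, $\ell(y,z)=\ell(z,y)$ and $\ell(y_1,y_2)\le c(\ell(y_1,y_3)+\ell(y_2,y_3))$. Let $X$ be a measurable space in which points are measurable (for instance any set with all its subsets), and $H\subseteq Y^X$. *One-inclusion graph dimension.* For $V\subseteq Y^n$ the one-inclusion graph of $V$ has vertex set $V$ and edges the non-empty sets $e_{i,f}=\{v\in V: v_j=f(j)\ \forall j\ne i\}$, for $i\in[n]$ and $f:[n]\setminus\{i\}\to Y$; let $e_{i,v}$ be the edge in direction $i$ through $v$. An orientation $\sigma$ picks a vertex $\sigma(e)\in e$ in every edge, and $\mathrm{outdeg}(v;\sigma,\gamma)=|\{i:\ell(\sigma(e_{i,v})_i,v_i)>\gamma\}|$. For $S=(x_1,\dots,x_n)\in X^n$ put $H|_S=\{(h(x_1),\dots,h(x_n)):h\in H\}$. Then $\mathbb D^{\mathrm{OIG}}_\gamma(H)\in\mathbb N\cup\{\infty\}$ is the supremum of all $n$ for which there are $S\in X^n$ and a finite $V\subseteq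 H|_S$ such that each orientation of the one-inclusion graph of $V$ (the induced subgraph on $V$) has a vertex $v\in V$ with $\mathrm{outdeg}(v;\sigma,\gamma)>n/3$. *Learning.* A learner $A$ maps each finite sample in $(X\times Y)^m$, $m\in\mathbb N$, to a function $X\to Y$. Let $\mathcal D$ be a set of probability distributions on $X$. For a sample size $m$, *cut-off error at most $\varepsilon$ at scale $\gamma$ with confidence $1-\delta$* means: for all $h\in H$ and $D\in\mathcal D$, with probability at least $1-\delta$ over $S\sim D^m$ labeled by $h$, $\Pr_{x\sim D}[\ell(A(S;x),h(x))>\gamma]\le\varepsilon$. $H$ is *cut-off PAC learnable* (realizable case) if one learner $A$ has this property for all $\varepsilon,\delta,\gamma\in(0,1)$ and all $m\ge n(\varepsilon,\delta,\gamma)$. It is *PAC learnable in expected loss* if one learner satisfies, for all $\varepsilon,\delta\in(0,1)$, all $m\ge n(\varepsilon,\delta)$, all $h\in H$ and $D\in\mathcal D$, $\mathbb E_{x\sim D}[\ell(A(S;x),h(x))]\le\varepsilon$ with probability at least $1-\delta$ over $S$. (Where an event is not measurable, outer probability is meant.) *Measurability.* $\mathcal D$ is either the set of all discrete distributions on $X$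 (those carried by a countable set), with no further condition on $H$, or the set of all probability distributions on $X$, provided that $H$ is admissible, i.e. for some $\sigma$-algebra on $Y$ the loss $\ell$ and all $h\in H$ are measurable and, for all $n,k\in\mathbb N$ and $\gamma>0$: if some $P:(X\times Y)^n\times X\to Y$ makes, for every $h\in H$ and every $n+1$ points labeled by $h$, at most $k$ leave-one-out errors larger than $\gamma$, then some such $P$ is measurable as a function of the $n$ sample points and the test point, for each labeling $h\in H$. **Theorem.** For every $\mathcal D$ as above: 1. $H$ is cut-off PAC learnable if and only if $\mathbb D^{\mathrm{OIG}}_\gamma(H)<\infty$ for all $\gamma\in(0,1)$. 2. If $H$ is PAC learnable in expected loss, then $\mathbb D^{\mathrm{OIG}}_\gamma(H)<\infty$ for all $\gamma\in(0,1)$; if $\ell$ is bounded, the converse holds too. Moreover there is a universal constant $C\ge 1$ (independent of $X,Y,\ell,c,H$) such that, with $\mathcal D$ the discrete distributions: 3. (Upper bound.) If $\gamma>0$ and $d=\mathbb D^{\mathrm{OIG}}_{\gamma/(2c)}(H)<\infty$, there is a learner which for all $m\ge 2$ and $\delta\in(0,1)$ has from $m$ examples, with confidence $1-\delta$, cut-off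 error at scale $\gamma$ at most $$C\,\frac{d\log^2 m+\log(1/\delta)}{m}.$$ 4. (Lower bound.) If $\gamma>0$, $0<\varepsilon,\delta<1/C$, and some learner has from $m$ examples, with confidence $1-\delta$, cut-off error at scale $\gamma$ at most $\varepsilon$, then $\mathbb D^{\mathrm{OIG}}_{2c\gamma}(H)$ is finite and at most $\max(1,C\varepsilon m)$. -/

import Mathlib

open MeasureTheory
open scoped NNReal ENNReal

universe u v

namespace RealizablePAC

variable {X : Type u} {Y : Type v}

/-- `ℓ` is a `c`-approximate pseudo-metric on `Y` (with `c ≥ 1`). -/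
structure IsApproxPseudoMetric (c : ℝ) (ℓ : Y → Y → ℝ≥0) : Prop where
  one_le : 1 ≤ c
  self_eq_zero : ∀ y, ℓ y y = 0
  symm : ∀ y z, ℓ y z = ℓ z y
  approx_triangle : ∀ y₁ y₂ y₃, (ℓ y₁ y₂ : ℝ) ≤ c * ((ℓ y₁ y₃ : ℝ) + (ℓ y₂ y₃ : ℝ))

section OneInclusionGraph

variable {n : ℕ}

/-- The projection of the class `H` to the sequence of points `S`. -/
def projection (H : Set (X → Y)) (S : Fin n → X) : Set (Fin n → Y) :=
  {v | ∃ h ∈ H, v = fun i => h (S i)}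

/-- The set of vertices of `V` that agree with `f` in all directions other than `i`. -/
def hyperedge (V : Set (Fin n → Y)) (i : Fin n) (f : {j : Fin n // j ≠ i} → Y) :
    Set (Fin n → Y) :=
  {v | v ∈ V ∧ ∀ j : {j : Fin n // j ≠ i}, v j.1 = f j}

/-- The (hyper)edges of the one-inclusion graph with vertex set `V ⊆ Y^n`.
If `V` is a subset of `W`, then the edges of the graph of `V` are the nonempty traces `e ∩ V` of
the edges `e` of the graph of `W`: the graph of `V` is the subgraph of the graph of `W` induced by
`V`. -/
def edgeSet (V : Set (Fin n → Y)) : Set (Set (Fin n → Y)) :=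
  {e | e.Nonempty ∧ ∃ (i : Fin n) (f : {j : Fin n // j ≠ i} → Y), e = hyperedge V i f}

/-- The edge in direction `i` through the vertex `v`. -/
def edgeThrough (V : Set (Fin n → Y)) (i : Fin n) (v : Fin n → Y) : Set (Fin n → Y) :=
  hyperedge V i (fun j => v j.1)

/-- An orientation picks a vertex in each edge (its values off the edge set play no role). -/
def IsOrientation (V : Set (Fin n → Y)) (σ : Set (Fin n → Y) → (Fin n → Y)) : Prop :=
  ∀ e ∈ edgeSet V, σ e ∈ e

/-- The out-degree of `v` under the orientation `σ`, at scale `γ`. -/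
noncomputable def outdeg (ℓ : Y → Y → ℝ≥0) (γ : ℝ) (V : Set (Fin n → Y))
    (σ : Set (Fin n → Y) → (Fin n → Y)) (v : Fin n → Y) : ℕ :=
  Set.ncard {i : Fin n | γ < (ℓ (σ (edgeThrough V i v) i) (v i) : ℝ)}

end OneInclusionGraph

/-- The one-inclusion graph dimension of `H` at scale `γ`: the supremum of the `n` for which some
`S ∈ X^n` and some finite (induced) subgraph of the one-inclusion graph of `H|_S` are such that each
orientation of that subgraph has a vertex of out-degree more than `n / 3`. -/
noncomputable def oigDim (ℓ : Y → Y → ℝ≥0) (γ : ℝ) (H : Set (X → Y)) : ℕ∞ :=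
  ⨆ n ∈ {n : ℕ | ∃ S : Fin n → X, ∃ V : Set (Fin n → Y), V.Finite ∧ V ⊆ projection H S ∧
      ∀ σ : Set (Fin n → Y) → (Fin n → Y), IsOrientation V σ →
        ∃ v ∈ V, (n : ℝ) / 3 < (outdeg ℓ γ V σ v : ℝ)}, (n : ℕ∞)

section Learning

/-- A learning algorithm: for each sample size, it maps labeled samples to predictors. -/
abbrev Learner (X : Type u) (Y : Type v) := (m : ℕ) → (Fin m → X × Y) → X → Y

/-- The sample `S`, labeled by `h`. -/
def labeled {m : ℕ} (h : X → Y) (S : Fin m → X) : Fin m → X × Y := fun i => (S i, h (S i))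

variable [MeasurableSpace X]

/-- All probability distributions on the measurable space `X`. -/
def distributions (X : Type u) [MeasurableSpace X] : Set (Measure X) :=
  {μ | IsProbabilityMeasure μ}

/-- The probability distributions carried by a countable set of points. -/
def discreteDistributions (X : Type u) [MeasurableSpace X] : Set (Measure X) :=
  {μ | IsProbabilityMeasure μ ∧ ∃ T : Set X, T.Countable ∧ μ Tᶜ = 0}

/-- Trained on `m` i.i.d. points labeled by a target in `H`, the algorithm `A` has, with probability
at least `1 - δ`, cut-off error `Pr[ℓ(A(S; x), h(x)) > γ]` at most `ε`, whatever the target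
`h ∈ H` and the domain distribution in `𝒟`. (A measure in Mathlib, at a set that is not
measurable, is the outer measure of that set: failure is then counted by outer probability.) -/
def CutoffGuarantee (ℓ : Y → Y → ℝ≥0) (H : Set (X → Y)) (𝒟 : Set (Measure X))
    {m : ℕ} (A : (Fin m → X × Y) → X → Y) (ε δ γ : ℝ) : Prop :=
  ∀ μ ∈ 𝒟, ∀ h ∈ H,
    Measure.pi (fun _ : Fin m => μ)
      {S | ENNReal.ofReal ε < μ {x | γ < (ℓ (A (labeled h S) x) (h x) : ℝ)}} ≤ ENNReal.ofReal δ

/-- The same for the expected loss `E[ℓ(A(S; x), h(x))]`. -/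
def LossGuarantee (ℓ : Y → Y → ℝ≥0) (H : Set (X → Y)) (𝒟 : Set (Measure X))
    {m : ℕ} (A : (Fin m → X × Y) → X → Y) (ε δ : ℝ) : Prop :=
  ∀ μ ∈ 𝒟, ∀ h ∈ H,
    Measure.pi (fun _ : Fin m => μ)
      {S | ENNReal.ofReal ε < ∫⁻ x, (ℓ (A (labeled h S) x) (h x) : ℝ≥0∞) ∂μ} ≤ ENNReal.ofReal δ

/-- Realizable PAC learnability of `H` in the cut-off sense. -/
def CutoffPACLearnable (ℓ : Y → Y → ℝ≥0) (H : Set (X → Y)) (𝒟 : Set (Measure X)) : Prop :=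
  ∃ A : Learner X Y, ∀ ε δ γ : ℝ, 0 < ε → ε < 1 → 0 < δ → δ < 1 → 0 < γ → γ < 1 →
    ∃ n : ℕ, ∀ m ≥ n, CutoffGuarantee ℓ H 𝒟 (A m) ε δ γ

/-- Realizable PAC learnability of `H` in the sense of expected loss. -/
def PACLearnable (ℓ : Y → Y → ℝ≥0) (H : Set (X → Y)) (𝒟 : Set (Measure X)) : Prop :=
  ∃ A : Learner X Y, ∀ ε δ : ℝ, 0 < ε → ε < 1 → 0 < δ → δ < 1 →
    ∃ n : ℕ, ∀ m ≥ n, LossGuarantee ℓ H 𝒟 (A m) ε δ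

/-- For every target `h ∈ H` and all `n + 1` points, at most `k` of the points get a
prediction that is off by more than `γ` when the predictor `P` is given the other `n` points,
labeled by `h`. -/
def LeaveOneOutBound (ℓ : Y → Y → ℝ≥0) (H : Set (X → Y)) (γ : ℝ) {n : ℕ}
    (P : (Fin n → X × Y) → X → Y) (k : ℕ) : Prop :=
  ∀ h ∈ H, ∀ S : Fin (n + 1) → X,
    Set.ncard {i : Fin (n + 1) |
      γ < (ℓ (P (labeled h (fun j => S (i.succAbove j))) (S i)) (h (S i)) : ℝ)} ≤ k

/-- The measure-theoretic regularity of a class that is used for distributions that are not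
discrete: for some σ-algebra on the labels, the loss and the members of the class are measurable,
and asking a predictor to be measurable does not spoil the worst-case leave-one-out bounds that
can be met. Every class is admissible when `X` is countable and discrete and the loss is measurable
for some σ-algebra. -/
def Admissible (ℓ : Y → Y → ℝ≥0) (H : Set (X → Y)) : Prop :=
  ∃ _ : MeasurableSpace Y,
    Measurable (fun p : Y × Y => ℓ p.1 p.2) ∧
    (∀ h ∈ H, Measurable h) ∧
    ∀ (n k : ℕ) (γ : ℝ), 0 < γ →
      (∃ P : (Fin n → X × Y) → X → Y, LeaveOneOutBound ℓ H γ P k) →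
      ∃ P : (Fin n → X × Y) → X → Y, LeaveOneOutBound ℓ H γ P k ∧
        ∀ h ∈ H, Measurable (fun q : (Fin n → X) × X => P (labeled h q.1) q.2)

end Learning

end RealizablePAC

/-!
Learnability and the one-inclusion graph dimension are compared through leave-one-out errors.

*From a finite dimension to a learner.* If `d` is the dimension at scale `γ / (2 c)`, every finite
one-inclusion graph on `d + 1` points has an orientation of out-degree at most `(d + 1) / 3`. Edges may
be infinite, so that the orientations themselves need not converge; but the sets of vertices that they
satisfy do, along an ultrafilter (`exists_good_of_forall_finite`). The outcome is a set-valued predictor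
(`exists_setPredictor`): it accepts labels that are pairwise within `γ` of each other, and rejects the
correct label for at most a third of `d + 1` points left out in turn. It is a weak learner. Boosting by
multiplicative weights (`exists_majority_of_weak`) turns it into a majority of `O(log m)` voters that
is right on a sample of size `m`. Two labels accepted by a majority of voters share a voter, hence are
within `γ` of each other, so the factor `2 c` in the scale is lost only once. As the voters depend on
a sub-sample of size `O(d log m)`, a union bound over sub-samples (`measure_exists_compression_le`)
bounds the error on fresh points.

*From a learner to orientations.* Let most of the weight lie on one of `n` points and a weight
proportional to `ε` be spread over the others. Most samples miss a given light point `i`, and such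
a sample depends on the edge in direction `i` only, not on the vertex. Orient the edge towards the label
that the learner predicts for most of these samples; the guarantee for the learner bounds the number
of directions in which a vertex is not satisfied (`card_not_satisfied_le`). A second heavy point takes
care of the direction of the first one.

*Arbitrary distributions.* A learner for the uniform distributions on `n + 1` points, voting over
sub-samples of the `n` points it is given, has few leave-one-out errors in the worst case
(`exists_leaveOneOutBound_of_cutoffGuarantee`). For an admissible class the same bound is met by a
measurable predictor, and then exchangeability (`prod_le_of_leaveOneOut`) and Markov's inequality
bound its error under any distribution.
-/

namespace RealizablePAC

variable {X : Type u} {Y : Type v}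

/-! ### Approximate pseudo-metrics and majority votes -/

theorem IsApproxPseudoMetric.le_of_common_center {c : ℝ} {ℓ : Y → Y → ℝ≥0}
    (hℓ : IsApproxPseudoMetric c ℓ) {γ : ℝ} {y y₁ y₂ : Y} (h₁ : (ℓ y y₁ : ℝ) ≤ γ)
    (h₂ : (ℓ y y₂ : ℝ) ≤ γ) : (ℓ y₁ y₂ : ℝ) ≤ 2 * c * γ := by
  have h := hℓ.approx_triangle y₁ y₂ y
  rw [hℓ.symm y₁ y, hℓ.symm y₂ y] at h
  nlinarith [hℓ.one_le]

/-- The outcome of a vote: a label `y` such that the set of voters `ω` with `Q ω y` belongs to the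
family `Maj` of winning coalitions, if there is such a label. -/
noncomputable def vote {Ω : Type*} [Nonempty Y] (Maj : Set Ω → Prop) (Q : Ω → Y → Prop) : Y :=
  Classical.epsilon fun y => Maj {ω | Q ω y}

/-- If any two winning coalitions share a voter and the labels that one voter accepts are close to
each other, then the outcome of the vote is close to every label with a winning coalition. -/
theorem vote_close {Ω : Type*} [Nonempty Y] {Maj : Set Ω → Prop} {Q : Ω → Y → Prop}
    {ℓ : Y → Y → ℝ≥0} {Γ : ℝ}
    (hMaj : ∀ A B : Set Ω, Maj A → Maj B → (A ∩ B).Nonempty)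
    (hQ : ∀ ω y y', Q ω y → Q ω y' → (ℓ y y' : ℝ) ≤ Γ) {y : Y} (hy : Maj {ω | Q ω y}) :
    (ℓ (vote Maj Q) y : ℝ) ≤ Γ := by
  obtain ⟨ω, h₁, h₂⟩ := hMaj _ _ (Classical.epsilon_spec (p := fun y => Maj {ω | Q ω y}) ⟨y, hy⟩) hy
  exact hQ ω _ _ h₁ h₂

/-- A set of more than half of the elements of a finite type. -/
def IsMajority {Ω : Type*} (A : Set Ω) : Prop := Nat.card Ω < 2 * A.ncard

theorem IsMajority.inter_nonempty {Ω : Type*} [Finite Ω] (A B : Set Ω) (hA : IsMajority A)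
    (hB : IsMajority B) : (A ∩ B).Nonempty := by
  rw [Set.nonempty_iff_ne_empty]
  intro h
  have h1 := Set.ncard_union_add_ncard_inter A B
  have h2 := Set.ncard_le_card (A ∪ B)
  rw [h, Set.ncard_empty] at h1
  unfold IsMajority at hA hB
  omega

/-! ### Orientations -/

/-- A vertex `v` counts as satisfied in direction `i` if `good v i`. If satisfied vertices of an
edge have labels close to each other in the direction of the edge, then an orientation towards
satisfied vertices has small loss at all satisfied vertices. -/
theorem exists_orientation [Nonempty Y] {n : ℕ} {c Γ : ℝ} (hΓ : 0 ≤ Γ) {ℓ : Y → Y → ℝ≥0}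
    (hℓ : IsApproxPseudoMetric c ℓ)
    (V : Set (Fin n → Y)) (good : (Fin n → Y) → Fin n → Prop)
    (hgood : ∀ v ∈ V, ∀ w ∈ V, ∀ i, (∀ j, j ≠ i → v j = w j) → good v i → good w i →
      (ℓ (v i) (w i) : ℝ) ≤ Γ) :
    ∃ σ, IsOrientation V σ ∧ ∀ v ∈ V, outdeg ℓ Γ V σ v ≤ Set.ncard {i | ¬ good v i} := by
  classical
  have key : ∀ e : Set (Fin n → Y), ∃ v, e ∈ edgeSet V → (v ∈ e ∧ ∀ i, ∀ w ∈ V,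
      e = edgeThrough V i w → good w i → (ℓ (v i) (w i) : ℝ) ≤ Γ) := by
    intro e
    by_cases he : e ∈ edgeSet V
    swap
    · exact ⟨Classical.arbitrary _, fun h => absurd h he⟩
    by_cases hex : ∃ i, ∃ w ∈ V, e = edgeThrough V i w ∧ good w i
    · obtain ⟨i, v, hvV, hev, hvi⟩ := hex
      refine ⟨v, fun _ => ⟨hev ▸ ⟨hvV, fun _ => rfl⟩, fun k w hwV hew hwk => ?_⟩⟩
      have h1 : w ∈ edgeThrough V i v := hev ▸ hew ▸ ⟨hwV, fun _ => rfl⟩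
      have h2 : v ∈ edgeThrough V k w := hew ▸ hev ▸ ⟨hvV, fun _ => rfl⟩
      by_cases hk : k = i
      · subst hk
        exact hgood v hvV w hwV k (fun j hj => h2.2 ⟨j, hj⟩) hvi hwk
      · -- an edge in two directions has only one vertex
        have h3 : w k = v k := h1.2 ⟨k, hk⟩
        rw [h3, hℓ.self_eq_zero]
        exact_mod_cast hΓ
    · obtain ⟨v, hv⟩ := he.1
      exact ⟨v, fun _ => ⟨hv, fun i w hw hew hg => absurd ⟨i, w, hw, hew, hg⟩ hex⟩⟩
  choose σ hσ using key
  refine ⟨σ, fun e he => (hσ e he).1, fun v hv => Set.ncard_le_ncard ?_ (Set.toFinite _)⟩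
  intro i hi hg
  have he : edgeThrough V i v ∈ edgeSet V := ⟨⟨v, hv, fun _ => rfl⟩, i, _, rfl⟩
  exact not_le.2 (hi : Γ < _) ((hσ _ he).2 i v hv rfl hg)

/-- Compactness. The orientations of the finite induced subgraphs do not converge, as edges may be
infinite; but which vertices they satisfy does converge along an ultrafilter, and any two satisfied
vertices of an edge stay close to a common label. -/
theorem exists_good_of_forall_finite {n k : ℕ} {γ : ℝ} {ℓ : Y → Y → ℝ≥0} (W : Set (Fin n → Y))
    (hW : ∀ V : Set (Fin n → Y), V.Finite → V ⊆ W →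
      ∃ σ, IsOrientation V σ ∧ ∀ v ∈ V, outdeg ℓ γ V σ v ≤ k) :
    ∃ good : (Fin n → Y) → Fin n → Prop,
      (∀ v ∈ W, Set.ncard {i | ¬ good v i} ≤ k) ∧
      ∀ v ∈ W, ∀ w ∈ W, ∀ i, (∀ j, j ≠ i → v j = w j) → good v i → good w i →
        ∃ y, (ℓ y (v i) : ℝ) ≤ γ ∧ (ℓ y (w i) : ℝ) ≤ γ := by
  classical
  let V : Finset (Fin n → Y) → Set (Fin n → Y) := fun F => ↑F ∩ W
  choose σ _ hσ using fun F : Finset (Fin n → Y) =>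
    hW (V F) (F.finite_toSet.inter_of_left W) Set.inter_subset_right
  let U : Ultrafilter (Finset (Fin n → Y)) := Ultrafilter.of Filter.atTop
  have hmem : ∀ v ∈ W, ∀ᶠ F in U, v ∈ V F := fun v hv =>
    Ultrafilter.of_le Filter.atTop ((Filter.eventually_ge_atTop {v}).mono fun F hF =>
      ⟨by simpa using hF, hv⟩)
  refine ⟨fun v i => ∀ᶠ F in U, (ℓ (σ F (edgeThrough (V F) i v) i) (v i) : ℝ) ≤ γ, ?_, ?_⟩
  · intro v hv
    have h1 : ∀ᶠ F in U, ∀ i : Fin n,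
        (¬ ∀ᶠ F in U, (ℓ (σ F (edgeThrough (V F) i v) i) (v i) : ℝ) ≤ γ) →
          ¬ (ℓ (σ F (edgeThrough (V F) i v) i) (v i) : ℝ) ≤ γ := by
      rw [Filter.eventually_all]
      intro i
      by_cases h : ∀ᶠ F in U, (ℓ (σ F (edgeThrough (V F) i v) i) (v i) : ℝ) ≤ γ
      · exact Filter.Eventually.of_forall fun F h' => absurd h h'
      · exact (Ultrafilter.eventually_not.2 h).mono fun F hF _ => hF
    obtain ⟨F, hF, hvF⟩ := (h1.and (hmem v hv)).exists
    refine le_trans (Set.ncard_le_ncard ?_ (Set.toFinite _)) (hσ F v hvF)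
    intro i hi
    exact not_le.1 (hF i hi)
  · intro v hv w hw i hvw h1 h2
    obtain ⟨F, hF1, hF2⟩ := (h1.and h2).exists
    have : edgeThrough (V F) i v = edgeThrough (V F) i w := by
      unfold edgeThrough
      congr 1
      funext j
      exact hvw j.1 j.2
    exact ⟨_, hF1, this ▸ hF2⟩

/-- A size beyond the one-inclusion graph dimension admits orientations with small out-degrees. -/
theorem exists_orientation_of_oigDim_lt {γ : ℝ} {ℓ : Y → Y → ℝ≥0} {H : Set (X → Y)} {n : ℕ}
    (hd : oigDim ℓ γ H < n) (S : Fin n → X) (V : Set (Fin n → Y)) (hV : V.Finite)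
    (hVS : V ⊆ projection H S) :
    ∃ σ, IsOrientation V σ ∧ ∀ v ∈ V, outdeg ℓ γ V σ v ≤ n / 3 := by
  by_contra hcon
  push Not at hcon
  refine absurd hd (not_lt.2 ?_)
  unfold oigDim
  refine le_iSup₂_of_le n ⟨S, V, hV, hVS, fun σ hσ => ?_⟩ le_rfl
  obtain ⟨v, hv, h⟩ := hcon σ hσ
  refine ⟨v, hv, ?_⟩
  rw [div_lt_iff₀ (by norm_num)]
  have : n < outdeg ℓ γ V σ v * 3 := by omega
  exact_mod_cast this

/-! ### Set-valued leave-one-out predictors -/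

/-- Two sequences that differ by a permutation. -/
def permSetoid (X : Type u) (n : ℕ) : Setoid (Fin n → X) where
  r S S' := ∃ π : Equiv.Perm (Fin n), S' = S ∘ π
  iseqv :=
    { refl := fun S => ⟨1, rfl⟩
      symm := by
        rintro S _ ⟨π, rfl⟩
        exact ⟨π⁻¹, by funext i; simp⟩
      trans := by
        rintro S _ _ ⟨π, rfl⟩ ⟨τ, rfl⟩
        exact ⟨π * τ, rfl⟩ }

/-- A representative of each sequence up to permutations. -/
theorem exists_perm_representative (X : Type u) (n : ℕ) :
    ∃ rep : (Fin n → X) → (Fin n → X), (∀ S, ∃ π : Equiv.Perm (Fin n), rep S = S ∘ π) ∧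
      ∀ S (π : Equiv.Perm (Fin n)), rep (S ∘ π) = rep S := by
  refine ⟨fun S => (Quotient.mk (permSetoid X n) S).out, fun S => ?_, fun S π => ?_⟩
  · exact (permSetoid X n).symm (Quotient.exact (Quotient.out_eq (Quotient.mk (permSetoid X n) S)))
  · have : Quotient.mk (permSetoid X n) (S ∘ π) = Quotient.mk (permSetoid X n) S :=
      Quotient.sound ((permSetoid X n).symm ⟨π, rfl⟩)
    simp only [this]

/-- The set-valued one-inclusion predictor: given `d` labeled points `T` and a test point `x`, it
accepts the labels `y` with `Sat T x y`. Accepted labels are close to each other, and at most a third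
of the correct labels are rejected in a leave-one-out test. Accepting several labels, rather than
predicting a center of them, saves a factor `2 c` in the scale. -/
theorem exists_setPredictor {c γ : ℝ} (hγ : 0 ≤ γ) {ℓ : Y → Y → ℝ≥0}
    (hℓ : IsApproxPseudoMetric c ℓ) {H : Set (X → Y)} {d : ℕ} (hd : oigDim ℓ γ H = d) :
    ∃ Sat : (Fin d → X × Y) → X → Y → Prop,
      (∀ T x y y', Sat T x y → Sat T x y' → (ℓ y y' : ℝ) ≤ 2 * c * γ) ∧
      ∀ h ∈ H, ∀ S : Fin (d + 1) → X,
        3 * Set.ncard {i | ¬ Sat (labeled h fun j => S (i.succAbove j)) (S i) (h (S i))} ≤ d + 1 := by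
  have hd' : oigDim ℓ γ H < (d + 1 : ℕ) := by
    rw [hd]; exact_mod_cast Nat.lt_succ_self d
  choose good hcard hclose using fun S : Fin (d + 1) → X =>
    exists_good_of_forall_finite (projection H S) (exists_orientation_of_oigDim_lt hd' S)
  obtain ⟨rep, hrep, hinv⟩ := exists_perm_representative X (d + 1)
  let full : (Fin d → X × Y) → X → Fin (d + 1) → X := fun T x => Fin.cons x fun k => (T k).1
  refine ⟨fun T x y => ∃ h ∈ H, (∀ k, h (T k).1 = (T k).2) ∧ h x = y ∧
    ((∀ k, (T k).1 ≠ x) → ∃ j, rep (full T x) j = x ∧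
      good (rep (full T x)) (fun k => h (rep (full T x) k)) j), ?_, ?_⟩
  · rintro T x _ _ ⟨h, hH, hT, rfl, hg⟩ ⟨h', hH', hT', rfl, hg'⟩
    by_cases hx : h x = h' x
    · rw [hx, hℓ.self_eq_zero]
      have := hℓ.one_le
      push_cast
      positivity
    have hnot : ∀ k, (T k).1 ≠ x := by
      rintro k rfl
      exact hx ((hT k).trans (hT' k).symm)
    obtain ⟨j, hj, hgj⟩ := hg hnot
    obtain ⟨j', hj', hgj'⟩ := hg' hnot
    obtain ⟨π, hπ⟩ := hrep (full T x)
    -- the test point occurs only once, at the place `0` of `full T x`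
    have hzero : ∀ k, full T x k = x → k = 0 := by
      intro k
      refine Fin.cases (fun _ => rfl) (fun k hk => absurd hk (hnot k)) k
    have hπj : ∀ k, rep (full T x) k = x → π k = 0 := fun k hk =>
      hzero _ (by rw [hπ] at hk; exact hk)
    have hjj : j' = j := π.injective ((hπj j' hj').trans (hπj j hj).symm)
    subst hjj
    obtain ⟨y, h1, h2⟩ := hclose (rep (full T x)) _ ⟨h, hH, rfl⟩ _ ⟨h', hH', rfl⟩ j' (by
      intro k hk
      have hk0 : π k ≠ 0 := fun h0 => hk (π.injective (h0.trans (hπj j' hj).symm))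
      obtain ⟨l, hl⟩ := Fin.exists_succ_eq.2 hk0
      have : rep (full T x) k = (T l).1 := by rw [hπ, Function.comp, ← hl]; rfl
      simp only [this, hT, hT']) hgj hgj'
    rw [hj] at h1 h2
    exact hℓ.le_of_common_center h1 h2
  · intro h hH S
    obtain ⟨π, hπ⟩ := hrep S
    have hcount := (Set.ncard_image_le (f := π)
      (Set.toFinite {j | ¬ good (rep S) (fun k => h (rep S k)) j})).trans
      (hcard (rep S) (fun k => h (rep S k)) ⟨h, hH, rfl⟩)
    refine (Nat.mul_le_mul_left 3 ((Set.ncard_le_ncard ?_ (Set.toFinite _)).trans hcount)).trans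
      (Nat.mul_div_le _ _)
    intro i hi
    have hfull : rep (full (labeled h fun j => S (i.succAbove j)) (S i)) = rep S := by
      rw [← hinv S i.cycleRange.symm]
      congr 1
      funext k
      refine Fin.cases ?_ (fun k => ?_) k
      · simp [full]
      · simp [full, labeled]
    refine ⟨π.symm i, fun hgood => hi ⟨h, hH, fun _ => rfl, rfl, fun _ => ⟨π.symm i, ?_, ?_⟩⟩,
      by simp⟩
    · rw [hfull, hπ]; simp
    · rw [hfull]; exact hgood

/-! ### Boosting -/

/-- The leave-one-out bound, averaged over i.i.d. points: under any weights on the sample points,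
some sub-sample of size `d` yields a set-valued predictor that rejects at most a third of the weight. -/
theorem exists_weak_predictor {d m : ℕ} (err : (Fin d → Fin m) → Fin m → Prop)
    (herr : ∀ J : Fin (d + 1) → Fin m,
      3 * Set.ncard {i | err (fun j => J (i.succAbove j)) (J i)} ≤ d + 1)
    (w : Fin m → ℝ) (hw : ∀ j, 0 ≤ w j) (hpos : 0 < ∑ j, w j) :
    ∃ T, 3 * ∑ j, (open Classical in if err T j then w j else 0) ≤ ∑ j, w j := by
  classical
  by_contra! hcon
  set W := ∑ j, w j
  -- both sides average the number of leave-one-out errors over `d + 1` draws from the weights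
  have h1 : ∀ i : Fin (d + 1), ∑ J : Fin (d + 1) → Fin m, (∏ k, w (J k)) *
      (if err (fun j => J (i.succAbove j)) (J i) then 1 else 0) =
      ∑ T : Fin d → Fin m, (∏ k, w (T k)) * ∑ j, if err T j then w j else 0 := by
    intro i
    rw [← (Fin.insertNthEquiv (fun _ => Fin m) i).sum_comp, Fintype.sum_prod_type, Finset.sum_comm]
    refine Finset.sum_congr rfl fun T _ => ?_
    rw [Finset.mul_sum]
    refine Finset.sum_congr rfl fun j _ => ?_
    simp [Fin.insertNthEquiv, Fin.prod_univ_succAbove _ i, mul_comm]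
  have h2 : ∑ i : Fin (d + 1), ∑ J : Fin (d + 1) → Fin m, (∏ k, w (J k)) *
      (if err (fun j => J (i.succAbove j)) (J i) then (1 : ℝ) else 0) ≤
      W ^ (d + 1) * ((d + 1) / 3) := by
    rw [Finset.sum_comm, Fintype.sum_pow, Finset.sum_mul]
    refine Finset.sum_le_sum fun J _ => ?_
    rw [← Finset.mul_sum]
    refine mul_le_mul_of_nonneg_left ?_ (Finset.prod_nonneg fun k _ => hw _)
    have := herr J
    rw [Set.ncard_eq_toFinset_card'] at this
    simp only [Set.toFinset_ofPred] at this
    rw [Finset.sum_boole, le_div_iff₀ (by norm_num), mul_comm]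
    exact_mod_cast this
  rw [Finset.sum_congr rfl fun i _ => h1 i, Finset.sum_const, Finset.card_univ, Fintype.card_fin,
    nsmul_eq_mul] at h2
  have h3 : W ^ (d + 1) / 3 < ∑ T : Fin d → Fin m, (∏ k, w (T k)) * ∑ j, if err T j then w j else 0 := by
    have : W ^ (d + 1) / 3 = ∑ T : Fin d → Fin m, (∏ k, w (T k)) * (W / 3) := by
      rw [← Finset.sum_mul, ← Fintype.sum_pow]; ring
    rw [this]
    refine Finset.sum_lt_sum (fun T _ => mul_le_mul_of_nonneg_left ?_
      (Finset.prod_nonneg fun k _ => hw _)) ?_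
    · linarith [hcon T]
    · obtain ⟨j, hj⟩ : ∃ j, 0 < w j := by
        by_contra! h
        exact absurd hpos (not_lt.2 (Finset.sum_nonpos fun j _ => h j))
      refine ⟨fun _ => j, Finset.mem_univ _, ?_⟩
      refine mul_lt_mul_of_pos_left ?_ (Finset.prod_pos fun k _ => hj)
      linarith [hcon fun _ => j]
  have h4 : (0 : ℝ) < d + 1 := by positivity
  have h5 := mul_lt_mul_of_pos_left h3 h4
  push_cast at h2
  linarith

/-- Multiplicative weights: an element gets twice the weight with each error made on it, and each
round of a weak predictor multiplies the total weight by at most `4 / 3`. -/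
theorem exists_rounds {Ω : Type*} {m : ℕ} (hm : 0 < m) (err : Ω → Fin m → Prop)
    (hweak : ∀ w : Fin m → ℝ, (∀ j, 0 ≤ w j) → 0 < ∑ j, w j →
      ∃ T, 3 * ∑ j, (open Classical in if err T j then w j else 0) ≤ ∑ j, w j) (L : ℕ) :
    ∃ ω : Fin L → Ω, ∑ j, (2 : ℝ) ^ (∑ l, (open Classical in if err (ω l) j then 1 else 0)) ≤
      m * (4 / 3) ^ L := by
  classical
  induction L with
  | zero => exact ⟨Fin.elim0, by simp⟩
  | succ L ih =>
    obtain ⟨ω, hω⟩ := ih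
    have : Nonempty (Fin m) := ⟨⟨0, hm⟩⟩
    obtain ⟨T, hT⟩ := hweak (fun j => (2 : ℝ) ^ (∑ l, if err (ω l) j then 1 else 0))
      (fun j => by positivity) (Finset.sum_pos (fun j _ => by positivity) Finset.univ_nonempty)
    refine ⟨Fin.cons T ω, ?_⟩
    have : ∀ j, (2 : ℝ) ^ (∑ l, if err ((Fin.cons T ω : Fin (L + 1) → Ω) l) j then 1 else 0) =
        (2 : ℝ) ^ (∑ l, if err (ω l) j then 1 else 0) +
          if err T j then (2 : ℝ) ^ (∑ l, if err (ω l) j then 1 else 0) else 0 := by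
      intro j
      rw [Fin.sum_univ_succ]
      simp only [Fin.cons_zero, Fin.cons_succ]
      split_ifs
      · rw [pow_add]; ring
      · simp
    rw [Finset.sum_congr rfl fun j _ => this j, Finset.sum_add_distrib, pow_succ]
    linarith

/-- A majority of the predictors of sufficiently many rounds of boosting is right everywhere. -/
theorem exists_majority_of_weak {Ω : Type*} {m : ℕ} (hm : 0 < m) (err : Ω → Fin m → Prop)
    (hweak : ∀ w : Fin m → ℝ, (∀ j, 0 ≤ w j) → 0 < ∑ j, w j →
      ∃ T, 3 * ∑ j, (open Classical in if err T j then w j else 0) ≤ ∑ j, w j) {L : ℕ}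
    (hL : (m : ℝ) ^ 2 < (9 / 8) ^ L) :
    ∃ ω : Fin L → Ω, ∀ j, IsMajority {l | ¬ err (ω l) j} := by
  classical
  obtain ⟨ω, hω⟩ := exists_rounds hm err hweak L
  refine ⟨ω, fun j => ?_⟩
  have h1 : (2 : ℝ) ^ (∑ l, if err (ω l) j then 1 else 0) ≤ m * (4 / 3) ^ L :=
    (Finset.single_le_sum (f := fun j => (2 : ℝ) ^ (∑ l, if err (ω l) j then 1 else 0))
      (fun j _ => by positivity) (Finset.mem_univ j)).trans hω
  have hsum : ∑ l, (if err (ω l) j then 1 else 0) = Set.ncard {l | err (ω l) j} := by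
    rw [Set.ncard_eq_toFinset_card']
    simp
  rw [hsum] at h1
  have hcompl : Set.ncard {l | err (ω l) j} + Set.ncard {l | ¬ err (ω l) j} = L := by
    have := Set.ncard_add_ncard_compl {l | err (ω l) j}
    rwa [Nat.card_eq_fintype_card, Fintype.card_fin] at this
  unfold IsMajority
  rw [Nat.card_eq_fintype_card, Fintype.card_fin]
  by_contra hcon
  have hle : L ≤ 2 * Set.ncard {l | err (ω l) j} := by omega
  have h2 : (2 : ℝ) ^ L ≤ (2 : ℝ) ^ (2 * Set.ncard {l | err (ω l) j}) :=
    pow_le_pow_right₀ (by norm_num) hle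
  rw [mul_comm 2, pow_mul] at h2
  have h3 := h2.trans (pow_le_pow_left₀ (by positivity) h1 2)
  rw [mul_pow, ← pow_mul, mul_comm L 2, pow_mul] at h3
  have h4 : (2 : ℝ) ^ L = (9 / 8) ^ L * ((4 / 3) ^ 2) ^ L := by
    rw [← mul_pow]; norm_num
  rw [h4] at h3
  exact absurd (le_of_mul_le_mul_right h3 (by positivity)) (not_le.2 hL)

/-! ### Learners on distributions with finite support -/

section FiniteSupport

variable [MeasurableSpace X] [MeasurableSingletonClass X]

theorem map_mem_discreteDistributions {N : ℕ} (ν : Measure (Fin N)) [IsProbabilityMeasure ν]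
    (S : Fin N → X) : ν.map S ∈ discreteDistributions X := by
  have hS : Measurable S := measurable_from_top
  refine ⟨Measure.isProbabilityMeasure_map hS.aemeasurable, Set.range S, Set.countable_range S, ?_⟩
  rw [Measure.map_apply hS (Set.finite_range S).measurableSet.compl]
  have : S ⁻¹' (Set.range S)ᶜ = ∅ := by ext i; simp
  rw [this, measure_empty]

/-- Under the distribution of `S i`, where the index `i` is drawn from `ν`, a guarantee for the
learner bounds the mean number of errors over any set `I` of indices. Outside of the event
that the guarantee fails, the errors in `I` have weight at most `ε`, and otherwise at most `ν I`. -/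
theorem CutoffGuarantee.sum_error_le {ℓ : Y → Y → ℝ≥0} {H : Set (X → Y)} {m N : ℕ}
    {A : (Fin m → X × Y) → X → Y} {ε δ γ : ℝ} (hε : 0 ≤ ε) (hδ : 0 ≤ δ)
    (hA : CutoffGuarantee ℓ H (discreteDistributions X) A ε δ γ)
    (ν : Measure (Fin N)) [IsProbabilityMeasure ν] (S : Fin N → X) {h : X → Y} (hh : h ∈ H)
    (I : Finset (Fin N)) :
    ∑ i ∈ I, ν.real {i} * (Measure.pi fun _ : Fin m => ν).real
        {J | γ < (ℓ (A (labeled h (S ∘ J)) (S i)) (h (S i)) : ℝ)} ≤ ε + ν.real I * δ := by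
  classical
  set err : (Fin m → Fin N) → Set (Fin N) := fun J =>
    {i | γ < (ℓ (A (labeled h (S ∘ J)) (S i)) (h (S i)) : ℝ)}
  set G : Set (Fin m → Fin N) := {J | ENNReal.ofReal ε < ν (err J)}
  have hS : Measurable S := measurable_from_top
  have hν : IsProbabilityMeasure (ν.map S) := Measure.isProbabilityMeasure_map hS.aemeasurable
  have hG : (Measure.pi fun _ : Fin m => ν) G ≤ ENNReal.ofReal δ := by
    refine le_trans ?_ (hA _ (map_mem_discreteDistributions ν S) h hh)
    rw [← Measure.pi_map_pi (f := fun _ => S) (fun _ => hS.aemeasurable)]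
    refine le_trans (measure_mono ?_) (Measure.le_map_apply (f := fun (J : Fin m → Fin N) k => S (J k))
      (Measurable.of_discrete).aemeasurable _)
    intro J hJ
    exact lt_of_lt_of_le hJ (Measure.le_map_apply hS.aemeasurable _)
  have hpoint : ∀ J, ∑ i ∈ I, {J | i ∈ err J}.indicator (fun _ => ν {i}) J ≤
      ENNReal.ofReal ε + G.indicator (fun _ => ν I) J := by
    intro J
    have h1 : ∑ i ∈ I, {J | i ∈ err J}.indicator (fun _ => ν {i}) J =
        ν ((I.filter fun i => i ∈ err J : Finset (Fin N)) : Set (Fin N)) := by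
      rw [← sum_measure_singleton, Finset.sum_filter]
      rfl
    rw [h1]
    by_cases hJ : J ∈ G
    · rw [Set.indicator_of_mem hJ]
      exact (measure_mono fun i hi => (Finset.mem_filter.1 hi).1).trans le_add_self
    · rw [Set.indicator_of_notMem hJ, add_zero]
      exact (measure_mono fun i hi => by simpa using (Finset.mem_filter.1 hi).2).trans (not_lt.1 hJ)
  have hmain : ∑ i ∈ I, ν {i} * (Measure.pi fun _ : Fin m => ν) {J | i ∈ err J} ≤
      ENNReal.ofReal ε + ν I * ENNReal.ofReal δ := by
    calc ∑ i ∈ I, ν {i} * (Measure.pi fun _ : Fin m => ν) {J | i ∈ err J}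
        = ∫⁻ J, ∑ i ∈ I, {J | i ∈ err J}.indicator (fun _ => ν {i}) J
            ∂(Measure.pi fun _ : Fin m => ν) := by
          rw [lintegral_finsetSum _ fun i _ => Measurable.of_discrete]
          refine Finset.sum_congr rfl fun i _ => ?_
          rw [lintegral_indicator_const (.of_discrete)]
      _ ≤ ∫⁻ J, (ENNReal.ofReal ε + G.indicator (fun _ => ν I) J)
            ∂(Measure.pi fun _ : Fin m => ν) := lintegral_mono hpoint
      _ = ENNReal.ofReal ε + ν I * (Measure.pi fun _ : Fin m => ν) G := by
          rw [lintegral_add_left measurable_const, lintegral_const, measure_univ, mul_one,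
            lintegral_indicator_const (.of_discrete)]
      _ ≤ _ := by gcongr
  have h2 := ENNReal.toReal_mono (by finiteness) hmain
  rw [ENNReal.toReal_sum (fun i _ => by finiteness), ENNReal.toReal_add (by finiteness) (by finiteness),
    ENNReal.toReal_ofReal hε, ENNReal.toReal_mul, ENNReal.toReal_ofReal hδ] at h2
  simp only [ENNReal.toReal_mul] at h2
  exact h2

/-! ### Leave-one-out predictors from learners -/

theorem pow_succ_le_three_mul_pow {n m : ℕ} (hn : 1 ≤ n) (hmn : m ≤ n) :
    ((n : ℝ) + 1) ^ m ≤ 3 * (n : ℝ) ^ m := by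
  have hn' : (0 : ℝ) < n := by exact_mod_cast hn
  have h1 : ((n : ℝ) + 1) ^ m = (1 / (n : ℝ) + 1) ^ m * (n : ℝ) ^ m := by
    rw [← mul_pow]; congr 1; field_simp; ring
  have h2 : (1 / (n : ℝ) + 1) ^ m ≤ Real.exp 1 := by
    calc (1 / (n : ℝ) + 1) ^ m ≤ (Real.exp (1 / n)) ^ m :=
          pow_le_pow_left₀ (by positivity) (Real.add_one_le_exp _) m
      _ = Real.exp (m * (1 / n)) := (Real.exp_nat_mul _ _).symm
      _ ≤ Real.exp 1 := by
          refine Real.exp_le_exp.2 ?_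
          rw [mul_one_div, div_le_one hn']
          exact_mod_cast hmn
  rw [h1]
  have := Real.exp_one_lt_d9
  gcongr
  linarith

/-- The uniform distribution on `n + 1` indices; under its powers, probabilities are counts. -/
theorem exists_uniform_measure (n m : ℕ) :
    ∃ ν : Measure (Fin (n + 1)), IsProbabilityMeasure ν ∧ (∀ i, ν.real {i} = 1 / (n + 1)) ∧
      ∀ E : Set (Fin m → Fin (n + 1)),
        (Measure.pi fun _ : Fin m => ν).real E = E.ncard * (1 / (n + 1)) ^ m := by
  classical
  let w : Fin (n + 1) → ℝ≥0∞ := fun _ => ENNReal.ofReal (1 / (n + 1))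
  have hw : ∑ i, w i = 1 := by
    rw [Finset.sum_const, Finset.card_univ, Fintype.card_fin, nsmul_eq_mul,
      ← ENNReal.ofReal_natCast, ← ENNReal.ofReal_mul (by positivity)]
    push_cast
    rw [mul_one_div_cancel (by positivity), ENNReal.ofReal_one]
  set ν := (PMF.ofFintype w hw).toMeasure
  have hν : ∀ i, ν.real {i} = 1 / (n + 1) := by
    intro i
    have h0 : (0 : ℝ) ≤ 1 / (n + 1) := by positivity
    simp only [Measure.real, ν, PMF.toMeasure_apply_singleton _ _ (MeasurableSet.singleton i),
      PMF.ofFintype_apply, w, ENNReal.toReal_ofReal h0]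
  have hprob : IsProbabilityMeasure ν := PMF.toMeasure.isProbabilityMeasure _
  refine ⟨ν, hprob, hν, ?_⟩
  intro E
  have h1 : ∀ J : Fin m → Fin (n + 1),
      (Measure.pi fun _ : Fin m => ν).real {J} = (1 / (n + 1)) ^ m := by
    intro J
    rw [Measure.real, Measure.pi_singleton, ENNReal.toReal_prod]
    have : ∀ k, (ν {J k}).toReal = 1 / (n + 1) := fun k => hν (J k)
    rw [Finset.prod_congr rfl fun k _ => this k, Finset.prod_const, Finset.card_univ,
      Fintype.card_fin]
  have h2 := sum_measureReal_singleton (μ := Measure.pi fun _ : Fin m => ν) E.toFinset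
  rw [Set.coe_toFinset] at h2
  rw [← h2, Finset.sum_congr rfl fun J _ => h1 J, Finset.sum_const, nsmul_eq_mul,
    Set.ncard_eq_toFinset_card']

/-- A learner with a guarantee for the uniform distributions on `n + 1` points yields a
predictor with few leave-one-out errors: it lets all sub-samples of the given points vote.
A sub-sample of the `n` given points is a sub-sample of all `n + 1` points that misses the test point,
which happens with probability at least `1 / 3`. -/
theorem exists_leaveOneOutBound_of_cutoffGuarantee [Nonempty Y] {c : ℝ} {ℓ : Y → Y → ℝ≥0}
    (hℓ : IsApproxPseudoMetric c ℓ) {H : Set (X → Y)} {m : ℕ}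
    {A : (Fin m → X × Y) → X → Y} {ε δ γ : ℝ} (hε : 0 ≤ ε) (hδ : 0 ≤ δ)
    (hA : CutoffGuarantee ℓ H (discreteDistributions X) A ε δ γ) {n : ℕ} (hn : 1 ≤ n)
    (hmn : m ≤ n) :
    ∃ P : (Fin n → X × Y) → X → Y,
      LeaveOneOutBound ℓ H (2 * c * γ) P ⌊6 * (ε + δ) * (n + 1)⌋₊ := by
  classical
  refine ⟨fun T x => vote IsMajority fun (J : Fin m → Fin n) y => (ℓ (A (T ∘ J) x) y : ℝ) ≤ γ,
    fun h hh S => Nat.le_floor ?_⟩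
  set bad := {i : Fin (n + 1) | 2 * c * γ < (ℓ (vote IsMajority fun (J : Fin m → Fin n) y =>
    (ℓ (A (labeled h (fun j => S (i.succAbove j)) ∘ J) (S i)) y : ℝ) ≤ γ) (h (S i)) : ℝ)}
  obtain ⟨ν, hprob, hν, hpi⟩ := exists_uniform_measure n m
  have hbad : ∀ i ∈ bad, (1 : ℝ) / 6 ≤ (Measure.pi fun _ : Fin m => ν).real
      {J | γ < (ℓ (A (labeled h (S ∘ J)) (S i)) (h (S i)) : ℝ)} := by
    intro i hi
    set F : Set (Fin m → Fin n) := {J | (ℓ (A (labeled h (fun j => S (i.succAbove j)) ∘ J) (S i))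
      (h (S i)) : ℝ) ≤ γ}
    have hnot : ¬ IsMajority F := by
      intro hmaj
      have hclose := vote_close (Γ := 2 * c * γ) (ℓ := ℓ) IsMajority.inter_nonempty
        (Q := fun (J : Fin m → Fin n) y =>
          (ℓ (A (labeled h (fun j => S (i.succAbove j)) ∘ J) (S i)) y : ℝ) ≤ γ)
        (fun _ _ _ h1 h2 => hℓ.le_of_common_center h1 h2) hmaj
      exact not_le.2 hi hclose
    have hc := Set.ncard_add_ncard_compl F
    unfold IsMajority at hnot
    rw [Nat.card_eq_fintype_card, Fintype.card_fun, Fintype.card_fin, Fintype.card_fin] at hc hnot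
    have hFc : n ^ m ≤ 2 * Fᶜ.ncard := by omega
    have hinj : Function.Injective fun (J : Fin m → Fin n) k => i.succAbove (J k) := by
      intro J J' hJ
      funext k
      exact Fin.succAbove_right_injective (congrFun hJ k)
    have hsub : (fun (J : Fin m → Fin n) k => i.succAbove (J k)) '' Fᶜ ⊆
        {J | γ < (ℓ (A (labeled h (S ∘ J)) (S i)) (h (S i)) : ℝ)} := by
      rintro _ ⟨J, hJ, rfl⟩
      have h1 : ¬ (ℓ (A (labeled h (fun j => S (i.succAbove j)) ∘ J) (S i)) (h (S i)) : ℝ) ≤ γ := hJ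
      exact not_le.1 h1
    have hcard := Set.ncard_le_ncard hsub (Set.toFinite _)
    rw [Set.ncard_image_of_injective _ hinj] at hcard
    rw [hpi]
    have h1 : (n : ℝ) ^ m ≤ 2 * ({J | γ < (ℓ (A (labeled h (S ∘ J)) (S i)) (h (S i)) : ℝ)} :
        Set (Fin m → Fin (n + 1))).ncard := by
      exact_mod_cast hFc.trans (Nat.mul_le_mul_left 2 hcard)
    have h2 := pow_succ_le_three_mul_pow hn hmn
    rw [one_div_pow, mul_one_div, le_div_iff₀ (by positivity)]
    linarith
  have hsum := hA.sum_error_le hε hδ ν S hh bad.toFinset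
  have hle : ∑ i ∈ bad.toFinset, (1 / ((n : ℝ) + 1)) * (1 / 6) ≤ ε + δ := by
    refine le_trans (Finset.sum_le_sum fun i hi => ?_) (hsum.trans ?_)
    · rw [hν i]
      exact mul_le_mul_of_nonneg_left (hbad i (by simpa using hi)) (by positivity)
    · have : ν.real (bad.toFinset : Set (Fin (n + 1))) ≤ 1 := measureReal_le_one
      nlinarith
  rw [Finset.sum_const, nsmul_eq_mul, ← Set.ncard_eq_toFinset_card'] at hle
  have h3 : (0 : ℝ) < n + 1 := by positivity
  have h4 : (bad.ncard : ℝ) * (1 / ((n : ℝ) + 1) * (1 / 6)) = bad.ncard / (6 * (n + 1)) := by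
    field_simp
  rw [h4, div_le_iff₀ (by positivity)] at hle
  linarith

end FiniteSupport

/-! ### The lower bound -/

/-- The weight `1 - p` on the point `a`, and `p` spread over the other points. -/
noncomputable def heavyWeight {n : ℕ} (p : ℝ) (a i : Fin n) : ℝ≥0∞ :=
  if i = a then ENNReal.ofReal (1 - p) else ENNReal.ofReal (p / (n - 1))

theorem sum_heavyWeight {n : ℕ} (hn : 2 ≤ n) {p : ℝ} (hp0 : 0 ≤ p) (hp1 : p ≤ 1) (a : Fin n) :
    ∑ i, heavyWeight p a i = 1 := by
  classical
  have hn' : (2 : ℝ) ≤ n := by exact_mod_cast hn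
  rw [← Finset.add_sum_erase _ _ (Finset.mem_univ a)]
  have : ∀ i ∈ Finset.univ.erase a, heavyWeight p a i = ENNReal.ofReal (p / (n - 1)) :=
    fun i hi => if_neg (Finset.ne_of_mem_erase hi)
  rw [Finset.sum_congr rfl this, Finset.sum_const, Finset.card_erase_of_mem (Finset.mem_univ a),
    Finset.card_univ, Fintype.card_fin, nsmul_eq_mul, heavyWeight, if_pos rfl,
    ← ENNReal.ofReal_natCast, ← ENNReal.ofReal_mul (by positivity),
    ← ENNReal.ofReal_add (by linarith) (mul_nonneg (by positivity) (div_nonneg hp0 (by linarith))),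
    Nat.cast_sub (by omega), Nat.cast_one, mul_div_cancel₀ _ (by linarith)]
  simp

/-- The direction `i` is satisfied at the vertex `v` if most of the samples that miss the point `i`
lead the learner to a label close to `v i`. -/
def Satisfied (ℓ : Y → Y → ℝ≥0) (γ : ℝ) {m n : ℕ} (A : (Fin m → X × Y) → X → Y)
    (ν : Measure (Fin n)) (S : Fin n → X) (v : Fin n → Y) (i : Fin n) : Prop :=
  (Measure.pi fun _ : Fin m => ν) {J | ∀ k, J k ≠ i} <
    2 * (Measure.pi fun _ : Fin m => ν) {J | (∀ k, J k ≠ i) ∧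
      (ℓ (A (fun k => (S (J k), v (J k))) (S i)) (v i) : ℝ) ≤ γ}

theorem Satisfied.close {c γ : ℝ} {ℓ : Y → Y → ℝ≥0} (hℓ : IsApproxPseudoMetric c ℓ) {m n : ℕ}
    {A : (Fin m → X × Y) → X → Y} {ν : Measure (Fin n)} {S : Fin n → X} {v w : Fin n → Y}
    {i : Fin n} (hvw : ∀ j, j ≠ i → v j = w j) (hv : Satisfied ℓ γ A ν S v i)
    (hw : Satisfied ℓ γ A ν S w i) : (ℓ (v i) (w i) : ℝ) ≤ 2 * c * γ := by
  unfold Satisfied at hv hw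
  obtain ⟨J, ⟨hJ, hJv⟩, _, hJw⟩ := nonempty_inter_of_measure_lt_add
    (Measure.pi fun _ : Fin m => ν) (s := {J | (∀ k, J k ≠ i) ∧
      (ℓ (A (fun k => (S (J k), v (J k))) (S i)) (v i) : ℝ) ≤ γ})
    (t := {J | (∀ k, J k ≠ i) ∧ (ℓ (A (fun k => (S (J k), w (J k))) (S i)) (w i) : ℝ) ≤ γ})
    (u := {J | ∀ k, J k ≠ i}) .of_discrete (fun J h => h.1) (fun J h => h.1) (by
      by_contra hcon
      have h1 := ENNReal.add_lt_add hv hw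
      rw [← mul_add, ← two_mul] at h1
      exact absurd h1 (not_lt.2 (mul_le_mul_right (not_lt.1 hcon) 2)))
  have : (fun k => (S (J k), v (J k))) = fun k => (S (J k), w (J k)) := by
    funext k
    rw [hvw _ (hJ k)]
  rw [this] at hJv
  exact hℓ.le_of_common_center hJv hJw

section FiniteSupport

variable [MeasurableSpace X] [MeasurableSingletonClass X]

/-- With weight `1 - 32 ε` on the point `a`, a learner with error `ε` satisfies five sixths of the
other directions at every vertex: at least half of the samples miss any given light point, so each
direction that is not satisfied has an error with probability at least `1 / 4`, and the mean error
is of the order of `ε`, a small fraction of the light weight `32 ε`. -/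
theorem card_not_satisfied_le {γ : ℝ} {ℓ : Y → Y → ℝ≥0} {H : Set (X → Y)} {m n : ℕ}
    {A : (Fin m → X × Y) → X → Y} {ε δ : ℝ} (hε : 0 < ε) (hε' : 32 * ε ≤ 1) (hδ : 0 < δ)
    (hδ' : δ ≤ 1 / 200) (hA : CutoffGuarantee ℓ H (discreteDistributions X) A ε δ γ) (hn : 2 ≤ n)
    (hm : 200 * ε * m ≤ n) (S : Fin n → X) {h : X → Y} (hh : h ∈ H) (a : Fin n) :
    6 * Set.ncard {i | i ≠ a ∧ ¬ Satisfied ℓ γ A (PMF.ofFintype (heavyWeight (32 * ε) a)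
      (sum_heavyWeight hn (by positivity) hε' a)).toMeasure S (fun i => h (S i)) i} ≤ n - 1 := by
  classical
  set ν := (PMF.ofFintype (heavyWeight (32 * ε) a)
      (sum_heavyWeight hn (by positivity) hε' a)).toMeasure
  set bad := {i | i ≠ a ∧ ¬ Satisfied ℓ γ A ν S (fun i => h (S i)) i}
  have hn1 : (1 : ℝ) ≤ n - 1 := by
    have : (2 : ℝ) ≤ n := by exact_mod_cast hn
    linarith
  have hν : ∀ i, i ≠ a → ν.real {i} = 32 * ε / (n - 1) := by
    intro i hi
    have h0 : (0 : ℝ) ≤ 32 * ε / (n - 1) := by positivity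
    simp only [Measure.real, ν, PMF.toMeasure_apply_singleton _ _ (MeasurableSet.singleton i),
      PMF.ofFintype_apply, heavyWeight, if_neg hi, ENNReal.toReal_ofReal h0]
  have hmiss : ∀ i, i ≠ a → 1 / 2 ≤ (Measure.pi fun _ : Fin m => ν).real {J | ∀ k, J k ≠ i} := by
    intro i hi
    have h1 : {J : Fin m → Fin n | ∀ k, J k ≠ i} = (⋃ k, Function.eval k ⁻¹' {i})ᶜ := by
      ext J; simp
    rw [h1, probReal_compl_eq_one_sub .of_discrete]
    have h2 : (Measure.pi fun _ : Fin m => ν).real (⋃ k, Function.eval k ⁻¹' {i}) ≤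
        ∑ k : Fin m, (Measure.pi fun _ : Fin m => ν).real (Function.eval k ⁻¹' {i}) :=
      measureReal_iUnion_fintype_le _
    have h3 : ∀ k : Fin m, (Measure.pi fun _ : Fin m => ν).real (Function.eval k ⁻¹' {i}) =
        32 * ε / (n - 1) := by
      intro k
      rw [← hν i hi, Measure.real, Measure.real,
        (measurePreserving_eval (fun _ : Fin m => ν) k).measure_preimage
          (MeasurableSet.singleton i).nullMeasurableSet]
    rw [Finset.sum_congr rfl fun k _ => h3 k, Finset.sum_const, Finset.card_univ, Fintype.card_fin,
      nsmul_eq_mul] at h2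
    have h4 : (m : ℝ) * (32 * ε / (n - 1)) ≤ 1 / 2 := by
      rw [mul_div_assoc', div_le_iff₀ (by linarith)]
      nlinarith
    linarith
  have hbad : ∀ i ∈ bad, (1 : ℝ) / 4 ≤ (Measure.pi fun _ : Fin m => ν).real
      {J | γ < (ℓ (A (labeled h (S ∘ J)) (S i)) (h (S i)) : ℝ)} := by
    rintro i ⟨hia, hi⟩
    have h1 := hmiss i hia
    have h2 := ENNReal.toReal_mono (by finiteness) (not_lt.1 hi)
    rw [ENNReal.toReal_mul] at h2
    change 2 * (Measure.pi fun _ : Fin m => ν).real {J | (∀ k, J k ≠ i) ∧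
      (ℓ (A (labeled h (S ∘ J)) (S i)) (h (S i)) : ℝ) ≤ γ} ≤
      (Measure.pi fun _ : Fin m => ν).real {J | ∀ k, J k ≠ i} at h2
    have h3 : (Measure.pi fun _ : Fin m => ν).real {J | ∀ k, J k ≠ i} ≤ _ :=
      (measureReal_mono (fun J hJ => by
        by_cases hc : γ < (ℓ (A (labeled h (S ∘ J)) (S i)) (h (S i)) : ℝ)
        · exact Or.inr hc
        · exact Or.inl ⟨hJ, not_lt.1 hc⟩)).trans (measureReal_union_le {J | (∀ k, J k ≠ i) ∧
      (ℓ (A (labeled h (S ∘ J)) (S i)) (h (S i)) : ℝ) ≤ γ}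
        {J | γ < (ℓ (A (labeled h (S ∘ J)) (S i)) (h (S i)) : ℝ)})
    linarith
  have hsum := hA.sum_error_le hε.le hδ.le ν S hh bad.toFinset
  have hνbad : ν.real (bad.toFinset : Set (Fin n)) = bad.ncard * (32 * ε / (n - 1)) := by
    rw [← sum_measureReal_singleton, Finset.sum_congr rfl fun i hi => hν i (by
      rw [Set.mem_toFinset] at hi; exact hi.1), Finset.sum_const, nsmul_eq_mul,
      Set.ncard_eq_toFinset_card']
  have hle : ∑ i ∈ bad.toFinset, (32 * ε / (n - 1)) * (1 / 4) ≤
      ε + bad.ncard * (32 * ε / (n - 1)) * δ := by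
    rw [← hνbad]
    refine le_trans (Finset.sum_le_sum fun i hi => ?_) hsum
    rw [Set.mem_toFinset] at hi
    rw [hν i hi.1]
    exact mul_le_mul_of_nonneg_left (hbad i hi) (by positivity)
  rw [Finset.sum_const, nsmul_eq_mul, ← Set.ncard_eq_toFinset_card'] at hle
  have h5 : (bad.ncard : ℝ) * (32 * ε / (n - 1) * (1 / 4)) = ε * (bad.ncard * 8 / (n - 1)) := by
    ring
  have h6 : (bad.ncard : ℝ) * (32 * ε / (n - 1)) * δ = ε * (bad.ncard * 32 * δ / (n - 1)) := by
    ring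
  have h7 : (bad.ncard : ℝ) * 8 / (n - 1) ≤ 1 + bad.ncard * 32 * δ / (n - 1) := by
    rw [h5, h6] at hle
    refine le_of_mul_le_mul_left ?_ hε
    linarith
  rw [div_le_iff₀ (by linarith), add_mul, div_mul_cancel₀ _ (by linarith)] at h7
  have h8 : (6 : ℝ) * bad.ncard ≤ n - 1 := by
    have : (bad.ncard : ℝ) * δ ≤ bad.ncard * (1 / 200) := by gcongr
    nlinarith
  have h9 : ((6 * bad.ncard : ℕ) : ℝ) ≤ ((n - 1 : ℕ) : ℝ) := by
    rw [Nat.cast_sub (by omega)]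
    push_cast
    exact h8
  exact_mod_cast h9

/-- Every direction is controlled by the distribution with heavy point `i₀`, apart from the direction
`i₀` itself, for which the distribution with heavy point `i₁` is used. -/
theorem exists_orientation_of_cutoffGuarantee [Nonempty Y] {c γ : ℝ} (hγ : 0 ≤ γ)
    {ℓ : Y → Y → ℝ≥0} (hℓ : IsApproxPseudoMetric c ℓ) {H : Set (X → Y)} {m n : ℕ}
    {A : (Fin m → X × Y) → X → Y} {ε δ : ℝ} (hε : 0 < ε) (hε' : 32 * ε ≤ 1) (hδ : 0 < δ)
    (hδ' : δ ≤ 1 / 200) (hA : CutoffGuarantee ℓ H (discreteDistributions X) A ε δ γ) (hn : 2 ≤ n)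
    (hm : 200 * ε * m ≤ n) (S : Fin n → X) {V : Set (Fin n → Y)} (hV : V ⊆ projection H S) :
    ∃ σ, IsOrientation V σ ∧ ∀ v ∈ V, 3 * outdeg ℓ (2 * c * γ) V σ v ≤ n := by
  let ν : Fin n → Measure (Fin n) := fun a => (PMF.ofFintype (heavyWeight (32 * ε) a)
      (sum_heavyWeight hn (by positivity) hε' a)).toMeasure
  let i₀ : Fin n := ⟨0, by omega⟩
  let i₁ : Fin n := ⟨1, by omega⟩
  have hne : i₀ ≠ i₁ := by simp [i₀, i₁]
  obtain ⟨σ, hσ, hout⟩ := exists_orientation (Γ := 2 * c * γ)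
    (mul_nonneg (by linarith [hℓ.one_le]) hγ) hℓ V
    (fun v i => Satisfied ℓ γ A (ν (if i = i₀ then i₁ else i₀)) S v i)
    (fun v _ w _ i hvw h1 h2 => h1.close hℓ hvw h2)
  refine ⟨σ, hσ, fun v hv => ?_⟩
  obtain ⟨h, hh, rfl⟩ := hV hv
  have h0 := card_not_satisfied_le hε hε' hδ hδ' hA hn hm S hh i₀
  have h1 := card_not_satisfied_le hε hε' hδ hδ' hA hn hm S hh i₁
  have h2 := (hout _ hv).trans (Set.ncard_le_ncard (t :=
    {i | i ≠ i₀ ∧ ¬ Satisfied ℓ γ A (ν i₀) S (fun i => h (S i)) i} ∪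
    {i | i ≠ i₁ ∧ ¬ Satisfied ℓ γ A (ν i₁) S (fun i => h (S i)) i}) (by
      intro i hi
      by_cases hii : i = i₀
      · right
        refine ⟨hii ▸ hne, ?_⟩
        simpa [hii] using hi
      · left
        refine ⟨hii, ?_⟩
        simpa [hii] using hi) (Set.toFinite _))
  have h3 := h2.trans (Set.ncard_union_le _ _)
  simp only [ν] at h3
  omega

/-- A learner with error `ε` from `m` examples bounds the one-inclusion graph dimension. -/
theorem oigDim_le_of_cutoffGuarantee [Nonempty Y] {c γ : ℝ} (hγ : 0 ≤ γ)
    {ℓ : Y → Y → ℝ≥0} (hℓ : IsApproxPseudoMetric c ℓ) {H : Set (X → Y)} {m : ℕ}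
    {A : (Fin m → X × Y) → X → Y} {ε δ : ℝ} (hε : 0 < ε) (hε' : 32 * ε ≤ 1) (hδ : 0 < δ)
    (hδ' : δ ≤ 1 / 200) (hA : CutoffGuarantee ℓ H (discreteDistributions X) A ε δ γ) :
    ∃ d : ℕ, oigDim ℓ (2 * c * γ) H = (d : ℕ∞) ∧ (d : ℝ) ≤ max 1 (200 * ε * m) := by
  have hle : oigDim ℓ (2 * c * γ) H ≤ (⌊max 1 (200 * ε * m)⌋₊ : ℕ∞) := by
    unfold oigDim
    refine iSup₂_le fun n hn => ?_
    rw [Nat.cast_le]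
    obtain ⟨S, V, -, hVS, hV⟩ := hn
    refine Nat.le_floor ?_
    by_contra! hcon
    obtain ⟨h1, h2⟩ := max_lt_iff.1 hcon
    have h1' : 1 < n := by exact_mod_cast h1
    obtain ⟨σ, hσ, hout⟩ := exists_orientation_of_cutoffGuarantee hγ hℓ hε hε' hδ hδ' hA h1' h2.le S hVS
    obtain ⟨v, hv, hvd⟩ := hV σ hσ
    rw [div_lt_iff₀ (by norm_num)] at hvd
    have h4 := hout v hv
    have h5 : n < outdeg ℓ (2 * c * γ) V σ v * 3 := by exact_mod_cast hvd
    omega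
  obtain ⟨d, hd⟩ := ENat.ne_top_iff_exists.1 (ne_top_of_le_ne_top (ENat.natCast_ne_top _) hle)
  refine ⟨d, hd.symm, ?_⟩
  rw [← hd, Nat.cast_le] at hle
  exact (Nat.cast_le.2 hle).trans (Nat.floor_le (le_max_of_le_left zero_le_one))

end FiniteSupport

/-! ### Discrete distributions -/

section Discrete

variable [MeasurableSpace X] [MeasurableSingletonClass X]

/-- A discrete distribution is the image of a distribution on a countable subtype, where all sets are
measurable. -/
theorem exists_map_val_of_mem_discreteDistributions {μ : Measure X}
    (hμ : μ ∈ discreteDistributions X) :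
    ∃ T : Set X, T.Countable ∧ ∃ ν : Measure T, IsProbabilityMeasure ν ∧
      ν.map Subtype.val = μ := by
  obtain ⟨hprob, T, hT, hTc⟩ := hμ
  have hemb := MeasurableEmbedding.subtype_coe hT.measurableSet
  have hmap : (μ.comap (Subtype.val : T → X)).map Subtype.val = μ := by
    rw [hemb.map_comap, Subtype.range_coe]
    exact Measure.restrict_eq_self_of_ae_mem hTc
  refine ⟨T, hT, _, ⟨?_⟩, hmap⟩
  rw [← Set.preimage_univ (f := (Subtype.val : T → X)), ← hemb.map_apply, hmap, measure_univ]

/-- No measurability of `E` is needed. -/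
theorem pi_map_val_apply {T : Set X} (hT : T.Countable) (ν : Measure T) [IsProbabilityMeasure ν]
    {m : ℕ} (E : Set (Fin m → X)) :
    (Measure.pi fun _ : Fin m => ν.map Subtype.val) E =
      (Measure.pi fun _ : Fin m => ν) {S | (fun k => (S k : X)) ∈ E} := by
  have : Countable T := hT
  have hemb : MeasurableEmbedding fun (S : Fin m → T) k => (S k : X) :=
    { injective := fun S S' h => funext fun k => Subtype.ext (congrFun h k)
      measurable := .of_discrete
      measurableSet_image' := fun s _ => (s.to_countable.image _).measurableSet }
  have : IsProbabilityMeasure (ν.map Subtype.val) :=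
    Measure.isProbabilityMeasure_map measurable_subtype_coe.aemeasurable
  rw [← Measure.pi_map_pi (f := fun _ => Subtype.val)
    (fun _ => measurable_subtype_coe.aemeasurable), hemb.map_apply]
  rfl

/-- Markov's inequality. -/
theorem LossGuarantee.cutoffGuarantee {ℓ : Y → Y → ℝ≥0} {H : Set (X → Y)} {m : ℕ}
    {A : (Fin m → X × Y) → X → Y} {ε δ γ : ℝ} (hγ : 0 < γ)
    (hA : LossGuarantee ℓ H (discreteDistributions X) A (γ * ε) δ) :
    CutoffGuarantee ℓ H (discreteDistributions X) A ε δ γ := by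
  intro μ hμ h hh
  refine le_trans (measure_mono fun S hS => ?_) (hA μ hμ h hh)
  obtain ⟨T, hT, ν, hν, rfl⟩ := exists_map_val_of_mem_discreteDistributions hμ
  have hcount : Countable T := hT
  have hemb := MeasurableEmbedding.subtype_coe hT.measurableSet
  simp only [Set.mem_ofPred_eq] at hS ⊢
  rw [hemb.map_apply] at hS
  rw [hemb.lintegral_map, ENNReal.ofReal_mul hγ.le]
  have hmarkov := mul_meas_ge_le_lintegral₀ (μ := ν)
    (f := fun x : T => (ℓ (A (labeled h S) x) (h x) : ℝ≥0∞)) (Measurable.of_discrete).aemeasurable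
    (ENNReal.ofReal γ)
  refine lt_of_lt_of_le ?_ hmarkov
  refine ENNReal.mul_lt_mul_right (by simpa using hγ) ENNReal.ofReal_ne_top
    (hS.trans_le (measure_mono fun x hx => ?_))
  have hx' : γ < (ℓ (A (labeled h S) x) (h x) : ℝ) := hx
  exact ENNReal.ofReal_le_of_le_toReal hx'.le

/-! ### The upper bound -/

/-- The failure probability of one compression: the points outside of the sub-sample `S ∘ J` are
independent of the set `B (S ∘ J)` of errors, and all of them miss it. -/
theorem measure_compression_le {Z : Type*} [MeasurableSpace Z] [MeasurableSingletonClass Z]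
    [Countable Z] (ν : Measure Z) [IsProbabilityMeasure ν] {ι : Type*} [Fintype ι] {m : ℕ}
    (B : (ι → Z) → Set Z) {ε : ℝ} (hε : 0 ≤ ε) (J : ι → Fin m) :
    (Measure.pi fun _ : Fin m => ν)
      {S | ENNReal.ofReal ε < ν (B (S ∘ J)) ∧ ∀ j, S j ∉ B (S ∘ J)} ≤
      ENNReal.ofReal (1 - ε) ^ (m - Fintype.card ι) := by
  classical
  let p : Fin m → Prop := fun j => j ∈ Set.range J
  let E : Set (({j // p j} → Z) × ({j // ¬ p j} → Z)) :=
    {q | ENNReal.ofReal ε < ν (B fun i => q.1 ⟨J i, i, rfl⟩) ∧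
      ∀ j, q.2 j ∉ B fun i => q.1 ⟨J i, i, rfl⟩}
  have hmp := measurePreserving_piEquivPiSubtypeProd (fun _ : Fin m => ν) p
  have hsub : {S | ENNReal.ofReal ε < ν (B (S ∘ J)) ∧ ∀ j, S j ∉ B (S ∘ J)} ⊆
      MeasurableEquiv.piEquivPiSubtypeProd (fun _ : Fin m => Z) p ⁻¹' E :=
    fun S hS => ⟨hS.1, fun j => hS.2 j.1⟩
  refine (measure_mono hsub).trans ?_
  rw [hmp.measure_preimage (MeasurableSet.of_discrete).nullMeasurableSet,
    Measure.prod_apply .of_discrete]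
  have hcard : m - Fintype.card ι ≤ Fintype.card {j // ¬ p j} := by
    rw [Fintype.card_subtype_compl, Fintype.card_fin]
    have : Fintype.card {j // p j} ≤ Fintype.card ι := Fintype.card_range_le J
    omega
  have hfiber : ∀ a, (Measure.pi fun _ : {j // ¬ p j} => ν) (Prod.mk a ⁻¹' E) ≤
      ENNReal.ofReal (1 - ε) ^ (m - Fintype.card ι) := by
    intro a
    set b : Set Z := B fun i => a ⟨J i, i, rfl⟩
    by_cases hε' : ENNReal.ofReal ε < ν b
    · have h1 : Prod.mk a ⁻¹' E ⊆ Set.univ.pi fun _ => bᶜ := fun q hq j _ => hq.2 j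
      refine (measure_mono h1).trans ?_
      rw [Measure.pi_pi, Finset.prod_const, Finset.card_univ, prob_compl_eq_one_sub .of_discrete]
      have h2 : 1 - ν b ≤ ENNReal.ofReal (1 - ε) := by
        rw [ENNReal.ofReal_sub _ hε, ENNReal.ofReal_one]
        exact tsub_le_tsub_left hε'.le 1
      have h3 : ENNReal.ofReal (1 - ε) ≤ 1 := ENNReal.ofReal_le_one.2 (by linarith)
      exact (pow_le_pow_left' h2 _).trans (pow_le_pow_right_of_le_one' h3 hcard)
    · have h1 : Prod.mk a ⁻¹' E = ∅ := by
        ext q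
        simp only [Set.mem_preimage, Set.mem_empty_iff_false, iff_false]
        exact fun hq => hε' hq.1
      rw [h1, measure_empty]
      exact zero_le
  refine (lintegral_mono hfiber).trans (le_of_eq ?_)
  rw [lintegral_const, measure_univ, mul_one]

theorem measure_exists_compression_le {Z : Type*} [MeasurableSpace Z] [MeasurableSingletonClass Z]
    [Countable Z] (ν : Measure Z) [IsProbabilityMeasure ν] {ι : Type*} [Fintype ι] {m : ℕ}
    (B : (ι → Z) → Set Z) {ε : ℝ} (hε : 0 ≤ ε) :
    (Measure.pi fun _ : Fin m => ν)
      {S | ∃ J : ι → Fin m, ENNReal.ofReal ε < ν (B (S ∘ J)) ∧ ∀ j, S j ∉ B (S ∘ J)} ≤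
      (m : ℝ≥0∞) ^ Fintype.card ι * ENNReal.ofReal (1 - ε) ^ (m - Fintype.card ι) := by
  classical
  rw [Set.ofPred_exists]
  refine (measure_iUnion_fintype_le _ _).trans ((Finset.sum_le_sum fun J _ =>
    measure_compression_le ν B hε J).trans ?_)
  rw [Finset.sum_const, Finset.card_univ, Fintype.card_fun, Fintype.card_fin, nsmul_eq_mul]
  push_cast
  rfl

/-- The number of rounds of boosting on `m` examples. The factor `18` is chosen as
`1 / 9 ≤ log (9 / 8)`, so that `m ^ 2 < (9 / 8) ^ rounds m`. -/
noncomputable def rounds (m : ℕ) : ℕ := ⌊18 * Real.log m⌋₊ + 1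

theorem log_ge_of_two_le {m : ℕ} (hm : 2 ≤ m) : (0.69 : ℝ) ≤ Real.log m := by
  have h1 := Real.log_two_gt_d9
  have h2 : Real.log 2 ≤ Real.log m := Real.log_le_log (by norm_num) (by exact_mod_cast hm)
  linarith

theorem rounds_le {m : ℕ} (hm : 2 ≤ m) : (rounds m : ℝ) ≤ 20 * Real.log m := by
  have h1 := log_ge_of_two_le hm
  have h2 := Nat.floor_le (a := 18 * Real.log m) (by positivity)
  unfold rounds
  push_cast
  linarith

theorem sq_lt_pow_rounds {m : ℕ} (hm : 2 ≤ m) : (m : ℝ) ^ 2 < (9 / 8) ^ rounds m := by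
  have hm' : (0 : ℝ) < m := by positivity
  have h1 : 18 * Real.log m < rounds m := by
    unfold rounds
    push_cast
    exact Nat.lt_floor_add_one _
  have h2 : (1 : ℝ) / 9 ≤ Real.log (9 / 8) := by
    have := Real.one_sub_inv_le_log_of_pos (x := 9 / 8) (by norm_num)
    norm_num at this ⊢
    exact this
  rw [← Real.log_lt_log_iff (by positivity) (by positivity), Real.log_pow, Real.log_pow]
  push_cast
  nlinarith

/-- The union bound over the sub-samples of size `rounds m * d`, evaluated at the claimed error. -/
theorem compression_bound {m d : ℕ} (hm : 2 ≤ m) {δ : ℝ} (hδ : 0 < δ) (hδ1 : δ < 1)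
    (hε : 200 * (d * Real.log m ^ 2 + Real.log (1 / δ)) / m < 1) :
    (m : ℝ) ^ (rounds m * d) *
      (1 - 200 * (d * Real.log m ^ 2 + Real.log (1 / δ)) / m) ^ (m - rounds m * d) ≤ δ := by
  have hm' : (0 : ℝ) < m := by positivity
  have hlog := log_ge_of_two_le hm
  have hr := rounds_le hm
  have hlogδ : 0 ≤ Real.log (1 / δ) := Real.log_nonneg (by rw [le_div_iff₀ hδ]; linarith)
  set ε := 200 * (d * Real.log m ^ 2 + Real.log (1 / δ)) / m with hεdef
  have hεm : ε * m = 200 * (d * Real.log m ^ 2 + Real.log (1 / δ)) := by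
    rw [hεdef]; field_simp
  have hε0 : 0 ≤ ε := by positivity
  have hd : (0 : ℝ) ≤ d := by positivity
  have hq : ((rounds m * d : ℕ) : ℝ) * Real.log m ≤ 20 * (d * Real.log m ^ 2) := by
    push_cast
    have := mul_le_mul_of_nonneg_right hr (mul_nonneg hd (by linarith : 0 ≤ Real.log m))
    nlinarith
  -- otherwise the sub-sample is half of the sample, and the bound on the error exceeds one
  have hhalf : (2 : ℝ) * (rounds m * d : ℕ) ≤ m := by
    by_contra! hcon
    have h1 : (m : ℝ) * 0.69 ≤ 2 * (rounds m * d : ℕ) * Real.log m :=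
      mul_le_mul hcon.le hlog (by norm_num) (by positivity)
    nlinarith
  have hle : rounds m * d ≤ m := by
    have : ((rounds m * d : ℕ) : ℝ) ≤ m := by
      have : (0 : ℝ) ≤ (rounds m * d : ℕ) := by positivity
      linarith
    exact_mod_cast this
  have h1 : (m : ℝ) ^ (rounds m * d) = Real.exp ((rounds m * d : ℕ) * Real.log m) := by
    rw [Real.exp_nat_mul, Real.exp_log hm']
  have h2 : (1 - ε) ^ (m - rounds m * d) ≤ Real.exp (-(ε * m / 2)) := by
    calc (1 - ε) ^ (m - rounds m * d) ≤ (Real.exp (-ε)) ^ (m - rounds m * d) :=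
          pow_le_pow_left₀ (by linarith) (Real.one_sub_le_exp_neg ε) _
      _ = Real.exp ((m - rounds m * d : ℕ) * -ε) := (Real.exp_nat_mul _ _).symm
      _ ≤ _ := by
          refine Real.exp_le_exp.2 ?_
          rw [Nat.cast_sub hle]
          nlinarith
  calc _ ≤ Real.exp ((rounds m * d : ℕ) * Real.log m) * Real.exp (-(ε * m / 2)) := by
        rw [h1]; gcongr
    _ = Real.exp ((rounds m * d : ℕ) * Real.log m + -(ε * m / 2)) := (Real.exp_add _ _).symm
    _ ≤ Real.exp (-Real.log (1 / δ)) := by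
        refine Real.exp_le_exp.2 ?_
        rw [hεm]
        nlinarith [sq_nonneg (Real.log m)]
    _ = δ := by rw [one_div, Real.log_inv, neg_neg, Real.exp_log hδ]

/-- The majority vote of boosted set-valued one-inclusion predictors is a compression scheme: it is
right on the sample, and depends on a sub-sample of size `d * rounds m` only. -/
theorem exists_learner_of_oigDim_eq [Nonempty Y] {c γ : ℝ} (hγ : 0 < γ) {ℓ : Y → Y → ℝ≥0}
    (hℓ : IsApproxPseudoMetric c ℓ) {H : Set (X → Y)} {d : ℕ}
    (hd : oigDim ℓ (γ / (2 * c)) H = d) :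
    ∃ A : Learner X Y, ∀ m : ℕ, 2 ≤ m → ∀ δ : ℝ, 0 < δ → δ < 1 →
      CutoffGuarantee ℓ H (discreteDistributions X) (A m)
        (200 * (d * Real.log m ^ 2 + Real.log (1 / δ)) / m) δ γ := by
  classical
  have hc := hℓ.one_le
  obtain ⟨Sat, hclose, hloo⟩ := exists_setPredictor (γ := γ / (2 * c)) (by positivity) hℓ hd
  rw [mul_div_cancel₀ _ (by positivity)] at hclose
  let Consistent : (m : ℕ) → (Fin m → X × Y) → (Fin (rounds m) × Fin d → Fin m) → Prop :=
    fun m S J => ∀ j, IsMajority {l | Sat (fun t => S (J (l, t))) (S j).1 (S j).2}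
  let A : Learner X Y := fun m S x =>
    if hJ : ∃ J, Consistent m S J then
      vote IsMajority fun l y => Sat (fun t => S (hJ.choose (l, t))) x y
    else Classical.arbitrary Y
  refine ⟨A, fun m hm δ hδ hδ1 μ hμ h hh => ?_⟩
  set ε := 200 * (d * Real.log m ^ 2 + Real.log (1 / δ)) / m with hεdef
  have hlogδ : 0 ≤ Real.log (1 / δ) := Real.log_nonneg (by rw [le_div_iff₀ hδ]; linarith)
  have hε0 : 0 ≤ ε := by positivity
  have hμ1 : IsProbabilityMeasure μ := hμ.1
  by_cases hε1 : 1 ≤ ε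
  · have hempty : {S : Fin m → X | ENNReal.ofReal ε <
        μ {x | γ < (ℓ (A m (labeled h S) x) (h x) : ℝ)}} = ∅ := by
      ext S
      simp only [Set.mem_ofPred_eq, Set.mem_empty_iff_false, iff_false, not_lt]
      exact prob_le_one.trans (ENNReal.one_le_ofReal.2 hε1)
    rw [hempty, measure_empty]
    exact zero_le
  obtain ⟨T, hT, ν, hν, rfl⟩ := exists_map_val_of_mem_discreteDistributions hμ
  have hcount : Countable T := hT
  have hemb := MeasurableEmbedding.subtype_coe hT.measurableSet
  let B : (Fin (rounds m) × Fin d → T) → Set T := fun a =>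
    {z | ¬ IsMajority {l | Sat (fun t => ((a (l, t) : X), h (a (l, t)))) z (h z)}}
  have hcons : ∀ S : Fin m → X, ∃ J, Consistent m (labeled h S) J := by
    intro S
    obtain ⟨ω, hω⟩ := exists_majority_of_weak (by omega)
      (fun (J : Fin d → Fin m) j => ¬ Sat (labeled h (S ∘ J)) (S j) (h (S j)))
      (exists_weak_predictor _ fun J => hloo h hh (S ∘ J)) (sq_lt_pow_rounds hm)
    refine ⟨fun q => ω q.1 q.2, fun j => ?_⟩
    have := hω j
    simp only [not_not] at this
    exact this
  rw [pi_map_val_apply hT]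
  refine (measure_mono fun S hS => ?_).trans ((measure_exists_compression_le ν B hε0).trans ?_)
  · rw [Set.mem_ofPred_eq, Set.mem_ofPred_eq, hemb.map_apply] at hS
    set S' : Fin m → X := fun k => S k
    have hJ := (hcons S').choose_spec
    refine ⟨(hcons S').choose, hS.trans_le (measure_mono fun z hz => ?_), fun j => not_not.2 (hJ j)⟩
    intro hmaj
    have hz' : γ < (ℓ (A m (labeled h S') z) (h z) : ℝ) := hz
    refine not_le.2 hz' ?_
    simp only [A, dif_pos (hcons S')]
    exact vote_close (Γ := γ) (ℓ := ℓ) IsMajority.inter_nonempty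
      (Q := fun l y => Sat (fun t => labeled h S' ((hcons S').choose (l, t))) z y)
      (fun l y y' h1 h2 => hclose _ _ y y' h1 h2) hmaj
  · rw [Fintype.card_prod, Fintype.card_fin, Fintype.card_fin, ← ENNReal.ofReal_natCast,
      ← ENNReal.ofReal_pow (by positivity), ← ENNReal.ofReal_pow (by linarith),
      ← ENNReal.ofReal_mul (by positivity)]
    exact ENNReal.ofReal_le_ofReal (compression_bound hm hδ hδ1 (not_le.1 hε1))

end Discrete

/-! ### Measurable leave-one-out predictors under arbitrary distributions -/

section Admissible

variable [MeasurableSpace X]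

/-- Exchangeability: under i.i.d. points, each point of a sample of size `n + 1` may serve as the test
point. -/
theorem prod_le_of_leaveOneOut (μ : Measure X) [IsProbabilityMeasure μ] {n k : ℕ}
    {E : Set ((Fin n → X) × X)} (hE : MeasurableSet E)
    (hk : ∀ S : Fin (n + 1) → X, Set.ncard {i | ((fun j => S (i.succAbove j)), S i) ∈ E} ≤ k) :
    (n + 1) * ((Measure.pi fun _ : Fin n => μ).prod μ) E ≤ k := by
  classical
  let F : Fin (n + 1) → Set (Fin (n + 1) → X) := fun i => {S | ((fun j => S (i.succAbove j)), S i) ∈ E}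
  have hmp : ∀ i : Fin (n + 1), MeasurePreserving
      (fun S : Fin (n + 1) → X => ((fun j => S (i.succAbove j)), S i))
      (Measure.pi fun _ => μ) ((Measure.pi fun _ : Fin n => μ).prod μ) := fun i =>
    Measure.measurePreserving_swap.comp (measurePreserving_piFinSuccAbove (fun _ => μ) i)
  have hF : ∀ i, (Measure.pi fun _ : Fin (n + 1) => μ) (F i) =
      ((Measure.pi fun _ : Fin n => μ).prod μ) E := fun i =>
    (hmp i).measure_preimage hE.nullMeasurableSet
  have hFm : ∀ i, MeasurableSet (F i) := fun i => (hmp i).measurable hE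
  calc (n + 1) * ((Measure.pi fun _ : Fin n => μ).prod μ) E
      = ∑ i, (Measure.pi fun _ : Fin (n + 1) => μ) (F i) := by
        rw [Finset.sum_congr rfl fun i _ => hF i, Finset.sum_const, Finset.card_univ,
          Fintype.card_fin, nsmul_eq_mul]
        push_cast
        rfl
    _ = ∫⁻ S, ∑ i, (F i).indicator (fun _ => 1) S ∂(Measure.pi fun _ : Fin (n + 1) => μ) := by
        rw [lintegral_finsetSum _ fun i _ => measurable_const.indicator (hFm i)]
        refine Finset.sum_congr rfl fun i _ => ?_
        rw [lintegral_indicator_const (hFm i), one_mul]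
    _ ≤ ∫⁻ _, k ∂(Measure.pi fun _ : Fin (n + 1) => μ) := by
        refine lintegral_mono fun S => ?_
        have h1 := hk S
        rw [Set.ncard_eq_toFinset_card', Set.toFinset_ofPred] at h1
        simp only [Set.indicator_apply]
        rw [Finset.sum_boole]
        exact_mod_cast h1
    _ = k := by rw [lintegral_const, measure_univ, mul_one]

theorem LeaveOneOutBound.cutoffGuarantee [MeasurableSpace Y] {ℓ : Y → Y → ℝ≥0}
    (hℓ : Measurable fun p : Y × Y => ℓ p.1 p.2) {H : Set (X → Y)} (hH : ∀ h ∈ H, Measurable h)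
    {γ ε δ : ℝ} (hε : 0 < ε) {n k : ℕ} {P : (Fin n → X × Y) → X → Y}
    (hP : LeaveOneOutBound ℓ H γ P k)
    (hPm : ∀ h ∈ H, Measurable fun q : (Fin n → X) × X => P (labeled h q.1) q.2)
    (hk : (k : ℝ) ≤ ε * δ * (n + 1)) :
    CutoffGuarantee ℓ H (distributions X) P ε δ γ := by
  intro μ hμ h hh
  have hprob : IsProbabilityMeasure μ := hμ
  let E : Set ((Fin n → X) × X) := {q | γ < (ℓ (P (labeled h q.1) q.2) (h q.2) : ℝ)}
  have hE : MeasurableSet E := measurableSet_lt measurable_const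
    (hℓ.comp ((hPm h hh).prodMk ((hH h hh).comp measurable_snd))).coe_nnreal_real
  have h1 := prod_le_of_leaveOneOut μ hE (hP h hh)
  have h2 : ((Measure.pi fun _ : Fin n => μ).prod μ) E ≤ ENNReal.ofReal (ε * δ) := by
    have h3 : (n + 1 : ℝ≥0∞) * ((Measure.pi fun _ : Fin n => μ).prod μ) E ≤
        (n + 1) * ENNReal.ofReal (ε * δ) := by
      refine h1.trans ?_
      have h4 : ENNReal.ofReal k ≤ ENNReal.ofReal ((n + 1 : ℕ) * (ε * δ)) :=
        ENNReal.ofReal_le_ofReal (by push_cast; linarith)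
      rw [ENNReal.ofReal_mul (by positivity), ENNReal.ofReal_natCast, ENNReal.ofReal_natCast] at h4
      exact_mod_cast h4
    exact (ENNReal.mul_le_mul_iff_right (by simp) (by finiteness)).1 h3
  rw [Measure.prod_apply hE, ENNReal.ofReal_mul hε.le] at h2
  have h5 := mul_meas_ge_le_lintegral₀ (μ := Measure.pi fun _ : Fin n => μ)
    (measurable_measure_prodMk_left (ν := μ) hE).aemeasurable (ENNReal.ofReal ε)
  have h6 := (ENNReal.mul_le_mul_iff_right (by simpa using hε) ENNReal.ofReal_ne_top).1 (h5.trans h2)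
  refine (measure_mono fun S hS => ?_).trans h6
  exact le_of_lt (show ENNReal.ofReal ε < μ (Prod.mk S ⁻¹' E) from hS)

end Admissible

/-! ### Learnability -/

section Learnability

variable [MeasurableSpace X]

theorem CutoffGuarantee.mono {ℓ : Y → Y → ℝ≥0} {H : Set (X → Y)} {𝒟 𝒟' : Set (Measure X)} {m : ℕ}
    {A : (Fin m → X × Y) → X → Y} {ε δ γ ε' δ' γ' : ℝ} (hA : CutoffGuarantee ℓ H 𝒟 A ε δ γ)
    (h𝒟 : 𝒟' ⊆ 𝒟) (hε : ε ≤ ε') (hδ : δ ≤ δ') (hγ : γ ≤ γ') :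
    CutoffGuarantee ℓ H 𝒟' A ε' δ' γ' := by
  intro μ hμ h hh
  refine (measure_mono fun S hS => ?_).trans
    ((hA μ (h𝒟 hμ) h hh).trans (ENNReal.ofReal_le_ofReal hδ))
  exact (ENNReal.ofReal_le_ofReal hε).trans_lt
    (lt_of_lt_of_le hS (measure_mono fun x hx => hγ.trans_lt hx))

/-- A single learner for all parameters: on `m` examples, it takes aim at `ε = δ = γ = 1 / (k + 2)`
for the largest `k ≤ m` for which `m` examples are known to suffice. -/
theorem cutoffPACLearnable_of_forall [Nonempty Y] {ℓ : Y → Y → ℝ≥0} {H : Set (X → Y)}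
    {𝒟 : Set (Measure X)}
    (hyp : ∀ ε δ γ : ℝ, 0 < ε → ε < 1 → 0 < δ → δ < 1 → 0 < γ → γ < 1 →
      ∃ n : ℕ, ∀ m ≥ n, ∃ A : (Fin m → X × Y) → X → Y, CutoffGuarantee ℓ H 𝒟 A ε δ γ) :
    CutoffPACLearnable ℓ H 𝒟 := by
  classical
  have hpos : ∀ k : ℕ, (0 : ℝ) < 1 / (k + 2) := fun k => by positivity
  have hlt : ∀ k : ℕ, (1 : ℝ) / (k + 2) < 1 := fun k => by
    rw [div_lt_one (by positivity)]
    have : (0 : ℝ) ≤ k := by positivity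
    linarith
  choose N hN using fun k : ℕ =>
    hyp _ _ _ (hpos k) (hlt k) (hpos k) (hlt k) (hpos k) (hlt k)
  have hN' : ∀ k m : ℕ, ∃ A : (Fin m → X × Y) → X → Y, N k ≤ m →
      CutoffGuarantee ℓ H 𝒟 A (1 / (k + 2)) (1 / (k + 2)) (1 / (k + 2)) := by
    intro k m
    by_cases h : N k ≤ m
    · obtain ⟨A, hA⟩ := hN k m h
      exact ⟨A, fun _ => hA⟩
    · exact ⟨fun _ _ => Classical.arbitrary Y, fun h' => absurd h' h⟩
  choose A hA using hN'
  refine ⟨fun m => A (Nat.findGreatest (fun k => N k ≤ m) m) m,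
    fun ε δ γ hε _ hδ _ hγ _ => ?_⟩
  obtain ⟨k, hk⟩ := exists_nat_one_div_lt (lt_min hε (lt_min hδ hγ))
  refine ⟨max k (N k), fun m hm => ?_⟩
  have hkm : k ≤ m := (le_max_left _ _).trans hm
  have hNk : N k ≤ m := (le_max_right _ _).trans hm
  have h1 : k ≤ Nat.findGreatest (fun k => N k ≤ m) m := Nat.le_findGreatest hkm hNk
  have h2 : N (Nat.findGreatest (fun k => N k ≤ m) m) ≤ m :=
    Nat.findGreatest_spec (P := fun k => N k ≤ m) hkm hNk
  have h3 : (1 : ℝ) / ((Nat.findGreatest (fun k => N k ≤ m) m : ℕ) + 2) ≤ min ε (min δ γ) := by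
    refine le_trans ?_ hk.le
    refine one_div_le_one_div_of_le (by positivity) ?_
    have : (k : ℝ) ≤ (Nat.findGreatest (fun k => N k ≤ m) m : ℕ) := by exact_mod_cast h1
    linarith
  exact (hA _ m h2).mono subset_rfl (h3.trans (min_le_left _ _))
    (h3.trans ((min_le_right _ _).trans (min_le_left _ _)))
    (h3.trans ((min_le_right _ _).trans (min_le_right _ _)))

/-- For a bounded loss, the loss is at most the cut-off, plus the bound on the event of an error. -/
theorem CutoffPACLearnable.pacLearnable {ℓ : Y → Y → ℝ≥0} {H : Set (X → Y)} {𝒟 : Set (Measure X)}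
    (h𝒟 : 𝒟 ⊆ distributions X) {B : ℝ≥0} (hB : ∀ y z, ℓ y z ≤ B)
    (hA : CutoffPACLearnable ℓ H 𝒟) : PACLearnable ℓ H 𝒟 := by
  obtain ⟨A, hA⟩ := hA
  refine ⟨A, fun ε δ hε hε1 hδ hδ1 => ?_⟩
  have hB0 : (0 : ℝ) ≤ B := B.2
  have hlt : ε / (2 * (B + 1)) < 1 := by
    rw [div_lt_one (by positivity)]
    linarith
  obtain ⟨n, hn⟩ := hA (ε / (2 * (B + 1))) δ (ε / 2) (by positivity) hlt hδ hδ1 (by positivity)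
    (by linarith)
  refine ⟨n, fun m hm μ hμ h hh => (measure_mono fun S hS => ?_).trans (hn m hm μ hμ h hh)⟩
  have hprob : IsProbabilityMeasure μ := h𝒟 hμ
  by_contra hcon
  rw [Set.mem_ofPred_eq, not_lt] at hcon
  rw [Set.mem_ofPred_eq] at hS
  refine absurd hS (not_lt.2 ?_)
  set E := {x | ε / 2 < (ℓ (A m (labeled h S) x) (h x) : ℝ)}
  calc ∫⁻ x, (ℓ (A m (labeled h S) x) (h x) : ℝ≥0∞) ∂μ
      ≤ ∫⁻ x, (ENNReal.ofReal (ε / 2) + E.indicator (fun _ => (B : ℝ≥0∞)) x) ∂μ := by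
        refine lintegral_mono fun x => ?_
        by_cases hx : x ∈ E
        · rw [Set.indicator_of_mem hx]
          exact le_add_left (ENNReal.coe_le_coe.2 (hB _ _))
        · rw [Set.indicator_of_notMem hx, add_zero]
          exact ENNReal.le_ofReal_iff_toReal_le ENNReal.coe_ne_top (by positivity) |>.2
            (not_lt.1 hx)
    _ = ENNReal.ofReal (ε / 2) + ∫⁻ x, E.indicator (fun _ => (B : ℝ≥0∞)) x ∂μ := by
        rw [lintegral_add_left measurable_const, lintegral_const, measure_univ, mul_one]
    _ ≤ ENNReal.ofReal (ε / 2) + B * ENNReal.ofReal (ε / (2 * (B + 1))) := by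
        gcongr
        exact (lintegral_indicator_const_le E _).trans (by gcongr)
    _ ≤ ENNReal.ofReal ε := by
        rw [← ENNReal.ofReal_coe_nnreal, ← ENNReal.ofReal_mul hB0,
          ← ENNReal.ofReal_add (by positivity) (by positivity)]
        refine ENNReal.ofReal_le_ofReal ?_
        have : (B : ℝ) * (ε / (2 * (B + 1))) ≤ ε / 2 := by
          rw [mul_div_assoc', div_le_div_iff₀ (by positivity) (by positivity)]
          nlinarith
        linarith

theorem discreteDistributions_subset_distributions :
    discreteDistributions X ⊆ distributions X := fun _ hμ => hμ.1

variable [MeasurableSingletonClass X] [Nonempty Y]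

theorem oigDim_lt_top_of_forall_cutoffGuarantee {c : ℝ} {ℓ : Y → Y → ℝ≥0}
    (hℓ : IsApproxPseudoMetric c ℓ) {H : Set (X → Y)}
    (hyp : ∀ ε δ γ : ℝ, 0 < ε → ε < 1 → 0 < δ → δ < 1 → 0 < γ → γ < 1 →
      ∃ (m : ℕ) (A : (Fin m → X × Y) → X → Y),
        CutoffGuarantee ℓ H (discreteDistributions X) A ε δ γ) {γ : ℝ} (hγ : 0 < γ) (hγ1 : γ < 1) :
    oigDim ℓ γ H < ⊤ := by
  have hc := hℓ.one_le
  have hγ' : γ / (2 * c) < 1 := by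
    rw [div_lt_one (by positivity)]
    linarith
  obtain ⟨m, A, hA⟩ := hyp (1 / 200) (1 / 200) (γ / (2 * c)) (by norm_num) (by norm_num)
    (by norm_num) (by norm_num) (by positivity) hγ'
  obtain ⟨d, hd, -⟩ := oigDim_le_of_cutoffGuarantee (by positivity) hℓ (by norm_num) (by norm_num)
    (by norm_num) le_rfl hA
  rw [mul_div_cancel₀ _ (by positivity)] at hd
  rw [hd]
  exact ENat.natCast_lt_top d

theorem eventually_exists_cutoffGuarantee {c : ℝ} {ℓ : Y → Y → ℝ≥0}
    (hℓ : IsApproxPseudoMetric c ℓ) {H : Set (X → Y)} {ε δ γ : ℝ} (hε : 0 < ε) (hδ : 0 < δ)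
    (hδ1 : δ < 1) (hγ : 0 < γ) (hdim : oigDim ℓ (γ / (2 * c)) H < ⊤) :
    ∃ n : ℕ, ∀ m ≥ n, ∃ A : (Fin m → X × Y) → X → Y,
      CutoffGuarantee ℓ H (discreteDistributions X) A ε δ γ := by
  obtain ⟨d, hd⟩ := ENat.ne_top_iff_exists.1 hdim.ne
  obtain ⟨A, hA⟩ := exists_learner_of_oigDim_eq hγ hℓ hd.symm
  have h1 : Filter.Tendsto (fun m : ℕ => Real.log m ^ 2 / (m : ℝ)) Filter.atTop (nhds 0) :=
    (Real.isLittleO_pow_log_id_atTop (n := 2)).tendsto_div_nhds_zero.comp tendsto_natCast_atTop_atTop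
  have h2 : Filter.Tendsto (fun m : ℕ => Real.log (1 / δ) / (m : ℝ)) Filter.atTop (nhds 0) :=
    tendsto_const_div_atTop_nhds_zero_nat _
  have h3 := ((h1.const_mul (200 * d : ℝ)).add (h2.const_mul 200))
  simp only [mul_zero, add_zero] at h3
  obtain ⟨n, hn⟩ := Filter.eventually_atTop.1 (h3.eventually_lt_const hε)
  refine ⟨max n 2, fun m hm => ⟨A m, (hA m ((le_max_right _ _).trans hm) δ hδ hδ1).mono subset_rfl
    ?_ le_rfl le_rfl⟩⟩
  have h4 := hn m ((le_max_left _ _).trans hm)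
  refine le_trans (le_of_eq ?_) h4.le
  ring

/-- For admissible classes, the detour from learning under discrete distributions to learning under
arbitrary ones goes through worst-case leave-one-out bounds, which can be met by measurable
predictors. -/
theorem eventually_exists_cutoffGuarantee_of_admissible {c : ℝ} {ℓ : Y → Y → ℝ≥0}
    (hℓ : IsApproxPseudoMetric c ℓ) {H : Set (X → Y)} (hH : Admissible ℓ H) {ε δ γ : ℝ}
    (hε : 0 < ε) (hε1 : ε < 1) (hδ : 0 < δ) (hδ1 : δ < 1) (hγ : 0 < γ)
    (hdim : oigDim ℓ (γ / (2 * c) / (2 * c)) H < ⊤) :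
    ∃ n : ℕ, ∀ m ≥ n, ∃ A : (Fin m → X × Y) → X → Y,
      CutoffGuarantee ℓ H (distributions X) A ε δ γ := by
  have hc := hℓ.one_le
  obtain ⟨_, hℓm, hHm, hadm⟩ := hH
  have hεδ : 0 < ε * δ / 12 := by positivity
  have hεδ1 : ε * δ / 12 < 1 := by nlinarith
  obtain ⟨m, hm⟩ := eventually_exists_cutoffGuarantee hℓ hεδ hεδ hεδ1 (by positivity) hdim
  obtain ⟨A, hA⟩ := hm m le_rfl
  refine ⟨max m 1, fun n hn => ?_⟩
  obtain ⟨P, hP, hPm⟩ := hadm n _ (2 * c * (γ / (2 * c))) (by positivity)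
    (exists_leaveOneOutBound_of_cutoffGuarantee hℓ hεδ.le hεδ.le hA
      ((le_max_right _ _).trans hn) ((le_max_left _ _).trans hn))
  rw [mul_div_cancel₀ _ (by positivity)] at hP
  refine ⟨P, hP.cutoffGuarantee hℓm hHm hε hPm ?_⟩
  refine (Nat.floor_le (by positivity)).trans (le_of_eq ?_)
  ring

end Learnability

end RealizablePAC

theorem mainTheorem5 :
    ∃ C : ℝ, 1 ≤ C ∧
      ∀ (X : Type u) (Y : Type v) [MeasurableSpace X] [MeasurableSingletonClass X] [Nonempty Y]
        (c : ℝ) (ℓ : Y → Y → ℝ≥0) (_ : RealizablePAC.IsApproxPseudoMetric c ℓ)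
        (H : Set (X → Y)),
        -- the characterization: for all discrete distributions, with no further condition, and
        -- for all distributions whatsoever if the class is admissible
        (∀ 𝒟 : Set (Measure X),
          (𝒟 = RealizablePAC.discreteDistributions X ∨
            (𝒟 = RealizablePAC.distributions X ∧ RealizablePAC.Admissible ℓ H)) →
          (RealizablePAC.CutoffPACLearnable ℓ H 𝒟 ↔
            ∀ γ : ℝ, 0 < γ → γ < 1 → RealizablePAC.oigDim ℓ γ H < ⊤) ∧
          (RealizablePAC.PACLearnable ℓ H 𝒟 →
            ∀ γ : ℝ, 0 < γ → γ < 1 → RealizablePAC.oigDim ℓ γ H < ⊤) ∧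
          ((∃ B : ℝ≥0, ∀ y z : Y, ℓ y z ≤ B) →
            (RealizablePAC.PACLearnable ℓ H 𝒟 ↔
              ∀ γ : ℝ, 0 < γ → γ < 1 → RealizablePAC.oigDim ℓ γ H < ⊤))) ∧
        -- the upper bound, in terms of the dimension at scale `γ / (2 c)`
        (∀ (γ : ℝ) (d : ℕ), 0 < γ → RealizablePAC.oigDim ℓ (γ / (2 * c)) H = (d : ℕ∞) →
          ∃ A : RealizablePAC.Learner X Y, ∀ m : ℕ, 2 ≤ m → ∀ δ : ℝ, 0 < δ → δ < 1 →
            RealizablePAC.CutoffGuarantee ℓ H (RealizablePAC.discreteDistributions X) (A m)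
              (C * (d * Real.log m ^ 2 + Real.log (1 / δ)) / m) δ γ) ∧
        -- the lower bound, in terms of the dimension at scale `2 c γ`
        (∀ (γ ε δ : ℝ) (m : ℕ) (A : (Fin m → X × Y) → X → Y),
          0 < γ → 0 < ε → ε < 1 / C → 0 < δ → δ < 1 / C →
          RealizablePAC.CutoffGuarantee ℓ H (RealizablePAC.discreteDistributions X) A ε δ γ →
          ∃ d : ℕ, RealizablePAC.oigDim ℓ (2 * c * γ) H = (d : ℕ∞) ∧
            (d : ℝ) ≤ max 1 (C * ε * m)) := by
  refine ⟨200, by norm_num, fun X Y _ _ _ c ℓ hℓ H => ⟨fun 𝒟 h𝒟 => ?_, fun γ d hγ hd =>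
    RealizablePAC.exists_learner_of_oigDim_eq hγ hℓ hd, fun γ ε δ m A hγ hε hε1 hδ hδ1 hA =>
    RealizablePAC.oigDim_le_of_cutoffGuarantee hγ.le hℓ hε (by linarith) hδ hδ1.le hA⟩⟩
  have hc := hℓ.one_le
  have hsub : RealizablePAC.discreteDistributions X ⊆ 𝒟 := by
    rcases h𝒟 with rfl | ⟨rfl, -⟩
    · exact subset_rfl
    · exact RealizablePAC.discreteDistributions_subset_distributions
  have hsup : 𝒟 ⊆ RealizablePAC.distributions X := by
    rcases h𝒟 with rfl | ⟨rfl, -⟩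
    · exact RealizablePAC.discreteDistributions_subset_distributions
    · exact subset_rfl
  have hscale : ∀ γ : ℝ, 0 < γ → γ < 1 → 0 < γ / (2 * c) ∧ γ / (2 * c) < 1 := by
    intro γ hγ hγ1
    refine ⟨by positivity, ?_⟩
    rw [div_lt_one (by positivity)]
    linarith
  have hlearn : (∀ γ : ℝ, 0 < γ → γ < 1 → RealizablePAC.oigDim ℓ γ H < ⊤) →
      RealizablePAC.CutoffPACLearnable ℓ H 𝒟 := by
    intro hdim
    refine RealizablePAC.cutoffPACLearnable_of_forall fun ε δ γ hε hε1 hδ hδ1 hγ hγ1 => ?_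
    obtain ⟨h1, h2⟩ := hscale γ hγ hγ1
    rcases h𝒟 with rfl | ⟨rfl, hadm⟩
    · exact RealizablePAC.eventually_exists_cutoffGuarantee hℓ hε hδ hδ1 hγ (hdim _ h1 h2)
    · obtain ⟨h3, h4⟩ := hscale _ h1 h2
      exact RealizablePAC.eventually_exists_cutoffGuarantee_of_admissible hℓ hadm hε hε1 hδ hδ1 hγ
        (hdim _ h3 h4)
  have hpac : RealizablePAC.PACLearnable ℓ H 𝒟 →
      ∀ γ : ℝ, 0 < γ → γ < 1 → RealizablePAC.oigDim ℓ γ H < ⊤ := by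
    rintro ⟨A, hA⟩ γ hγ hγ1
    refine RealizablePAC.oigDim_lt_top_of_forall_cutoffGuarantee hℓ
      (fun ε δ γ hε hε1 hδ hδ1 hγ hγ1 => ?_) hγ hγ1
    obtain ⟨n, hn⟩ := hA (γ * ε) δ (by positivity) (by nlinarith) hδ hδ1
    exact ⟨n, A n, RealizablePAC.LossGuarantee.cutoffGuarantee hγ
      fun μ hμ => hn n le_rfl μ (hsub hμ)⟩
  refine ⟨⟨?_, hlearn⟩, hpac, fun ⟨B, hB⟩ => ⟨hpac, fun hdim => (hlearn hdim).pacLearnable hsup hB⟩⟩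
  rintro ⟨A, hA⟩ γ hγ hγ1
  refine RealizablePAC.oigDim_lt_top_of_forall_cutoffGuarantee hℓ
    (fun ε δ γ hε hε1 hδ hδ1 hγ hγ1 => ?_) hγ hγ1
  obtain ⟨n, hn⟩ := hA ε δ γ hε hε1 hδ hδ1 hγ hγ1
  exact ⟨n, A n, (hn n le_rfl).mono hsub le_rfl le_rfl le_rfl⟩
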